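/- Let $k\ge 1$ be odd and $p\in[0,1]$. Consider the elephant random walk with $k$ extractions: the first $M\ge 1$ steps $X_1,\dots,X_M\in\{+1,-1\}$ are arbitrary and fixed (the initial condition), and for $N\ge M$, given $X_1,\dots,X_N$, one draws $k$ of these steps uniformly and independently (with replacement); with probability $p$ the step $X_{N+1}$ is the sign of the sum of the $k$ drawn steps, and with probability $1-p$ it is the opposite sign. Put $x_N=\frac1N\sum_{t\le N}X_t$, $$P_k(y)=\sum_{h=(k+1)/2}^{k}\binom kh y^h(1-y)^{k-h},\qquad \pi_k(y)=p\,P_k(y)+(1-p)\bigl(1-P_k(y)\bigr).$$ A solution $y$ of $\pi_k(y)=y$ is called stable (a down-crossing) if $\pi_k(z)>z$ for all $z<y$ close to $y$ and $\pi_k(z)<z$ for all $z>y$ close to $y$; it is called unstable (an up-crossing) if both inequalities are reversed. Say that $(k,p)$ is in the one-attractor phase if $1/2$ is the only solution of $\pi_k(y)=y$ in $[0,1]$, it is stable, and $x_N\to 0$ almost surely for every initial condition. Say that $(k,p)$ is in the two-attractor phase with attractors $\pm x$, where $0<x\le 1$, if - the solutions of $\pi_k(y)=y$ in $[0,1]$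 are exactly $\frac{1-x}2,\frac12,\frac{1+x}2$; the point $\frac12$ (average step $0$) is unstable and the other two are stable; - for every initial condition, almost surely $x_N$ converges to $x$ or to $-x$; - if $p<1$, then for every initial condition both limits $x$ and $-x$ have positive probability; - for every $\delta>0$ there are constants $C$ and $c>0$ (depending on $k,p,\delta$) such that, for every $M\ge1$ and every initial condition of length $M$, if $x_M\ge\delta$ then $\mathbb P(x_N\to -x)\le Ce^{-cM}$, and if $x_M\le-\delta$ then $\mathbb P(x_N\to x)\le Ce^{-cM}$. Then the following hold. 1. For $k=1$ and every $p\in[0,1)$, the one-attractor phase holds; in particular $x_N\to0$ almost surely for every initial condition. 2. For $k=3$: if $p\in[0,1/2)\cup[5/6,1]$, then $12p^2-16p+5\ge0$ and the real solutions of $\pi_3(y)=y$ are exactly $\frac12$ and $$y_\pm(p)=\frac12\pm\frac{\sqrt{12p^2-16p+5}}{2(2p-1)};$$ if $p\in[1/2,5/6)$, the only real solution is $\frac12$. 3. For $k=3$ and $p_c=5/6$: the one-attractor phase holds for every $p\in[0,p_c)$, and for every $p\in(p_c,1]$ the two-attractor phase holds with attractors $$x_\pm(p)=\pm\frac{\sqrt{12p^2-16p+5}}{2p-1}.$$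 4. For every odd $k>2$ there is $p_c=p_c(k)\in(1/2,1)$ such that the one-attractor phase holds for every $p\in[0,p_c)$, and for every $p\in(p_c,1]$ there is $x=x(k,p)\in(0,1]$ such that the two-attractor phase holds with attractors $\pm x$. -/

import Mathlib

open MeasureTheory ProbabilityTheory Filter Topology

/-- The numerical value `±1` of a step; `true` is a positive step, `false` a negative one. -/
def stepVal (b : Bool) : ℤ := if b then 1 else -1

/-- The majority direction of `k` extracted steps: positive iff their sum is positive.
For odd `k` there are no ties. -/
def majority {k : ℕ} (s : Fin k → Bool) : Bool := decide (0 < ∑ j, stepVal (s j))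

/-- The law of the next step of the walk, given the `n + 1` previous steps `h`:
`k` previous steps are extracted, uniformly and independently (with replacement), and the walk goes
in their majority direction with probability `p` and in the opposite direction otherwise. -/
noncomputable def nextStep (k : ℕ) (p : unitInterval) {n : ℕ} (h : Finset.Iic n → Bool) :
    PMF Bool :=
  haveI : Nonempty (Finset.Iic n) := ⟨⟨n, Finset.mem_Iic.2 le_rfl⟩⟩
  (PMF.uniformOfFintype (Fin k → Finset.Iic n)).bind fun i =>
    (bernoulliMeasure true false p).toPMF.map fun c =>
      if c then majority (fun j => h (i j)) else !(majority fun j => h (i j))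

/-- The transition kernels of the walk. -/
noncomputable def erwKernel (k : ℕ) (p : unitInterval) (n : ℕ) :
    Kernel (Finset.Iic n → Bool) Bool :=
  Kernel.ofFunOfCountable fun h => (nextStep k p h).toMeasure

instance (k : ℕ) (p : unitInterval) (n : ℕ) : IsMarkovKernel (erwKernel k p n) :=
  ⟨fun h => inferInstanceAs (IsProbabilityMeasure (nextStep k p h).toMeasure)⟩

/-- The law, on the space of infinite sequences of steps, of the elephant random walk with `k`
extractions and memory parameter `p`, whose first `m + 1` steps are prescribed to be `h`.
Steps are numbered from `0`. -/
noncomputable def erwLaw (k : ℕ) (p : unitInterval) {m : ℕ} (h : Finset.Iic m → Bool) :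
    Measure (ℕ → Bool) :=
  Kernel.traj (X := fun _ => Bool) (erwKernel k p) m h

/-- The average `x_N` of the first `N` steps. -/
noncomputable def avgStep (X : ℕ → Bool) (N : ℕ) : ℝ :=
  (∑ t ∈ Finset.range N, (stepVal (X t) : ℝ)) / N

/-- The average step `x_M` of an initial history of `M = m + 1` steps. -/
noncomputable def initAvg {m : ℕ} (h : Finset.Iic m → Bool) : ℝ :=
  (∑ t, (stepVal (h t) : ℝ)) / ((m : ℝ) + 1)

/-- The event that `x_N` converges to `x`. -/
def ConvergesTo (x : ℝ) : Set (ℕ → Bool) :=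
  {X | Tendsto (avgStep X) atTop (𝓝 x)}

/-- The polynomial `P_k`: the probability of a positive majority among `k` (odd) extractions when
the fraction of positive steps is `y`. -/
noncomputable def majorityProb (k : ℕ) (y : ℝ) : ℝ :=
  ∑ h ∈ Finset.Icc ((k + 1) / 2) k, (k.choose h : ℝ) * y ^ h * (1 - y) ^ (k - h)

/-- The urn function `π_k`. -/
noncomputable def urnFun (k : ℕ) (p y : ℝ) : ℝ :=
  p * majorityProb k y + (1 - p) * (1 - majorityProb k y)

/-- `f` crosses the diagonal at `y` from top to bottom (`y` is a stable equilibrium). -/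
def IsDownCrossing (f : ℝ → ℝ) (y : ℝ) : Prop :=
  f y = y ∧ (∀ᶠ z in 𝓝[<] y, z < f z) ∧ (∀ᶠ z in 𝓝[>] y, f z < z)

/-- `f` crosses the diagonal at `y` from bottom to top (`y` is an unstable equilibrium). -/
def IsUpCrossing (f : ℝ → ℝ) (y : ℝ) : Prop :=
  f y = y ∧ (∀ᶠ z in 𝓝[<] y, f z < z) ∧ (∀ᶠ z in 𝓝[>] y, z < f z)

/-- The phase with one attractor: `1/2` is the only equilibrium of the urn function in `[0, 1]`, it
is stable, and `x_N → 0` almost surely for every initial condition. -/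
def OneAttractorPhase (k : ℕ) (p : unitInterval) : Prop :=
  (∀ y ∈ Set.Icc (0 : ℝ) 1, urnFun k p y = y ↔ y = 1 / 2) ∧
  IsDownCrossing (urnFun k p) (1 / 2) ∧
  ∀ (m : ℕ) (h : Finset.Iic m → Bool), ∀ᵐ X ∂erwLaw k p h, X ∈ ConvergesTo 0

/-- The phase with the two attractors `±x`. The equilibria of the urn function in `[0, 1]` are
`(1 - x) / 2 < 1 / 2 < (1 + x) / 2`, the middle one being unstable and the other two stable.
For every initial condition `x_N` converges almost surely to `x` or `-x`, each of the two having
positive probability if `p < 1`. The probability of the attractor farther from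
the initial average step is exponentially small in the length `m + 1` of the initial history. -/
def TwoAttractorsPhase (k : ℕ) (p : unitInterval) (x : ℝ) : Prop :=
  0 < x ∧ x ≤ 1 ∧
  (∀ y ∈ Set.Icc (0 : ℝ) 1,
    urnFun k p y = y ↔ y = (1 - x) / 2 ∨ y = 1 / 2 ∨ y = (1 + x) / 2) ∧
  IsUpCrossing (urnFun k p) (1 / 2) ∧
  IsDownCrossing (urnFun k p) ((1 - x) / 2) ∧
  IsDownCrossing (urnFun k p) ((1 + x) / 2) ∧
  (∀ (m : ℕ) (h : Finset.Iic m → Bool),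
    ∀ᵐ X ∂erwLaw k p h, X ∈ ConvergesTo (-x) ∨ X ∈ ConvergesTo x) ∧
  ((p : ℝ) < 1 → ∀ (m : ℕ) (h : Finset.Iic m → Bool),
    0 < erwLaw k p h (ConvergesTo (-x)) ∧ 0 < erwLaw k p h (ConvergesTo x)) ∧
  (∀ δ : ℝ, 0 < δ → ∃ C c : ℝ, 0 < c ∧ ∀ (m : ℕ) (h : Finset.Iic m → Bool),
    (δ ≤ initAvg h →
      (erwLaw k p h).real (ConvergesTo (-x)) ≤ C * Real.exp (-c * ((m : ℝ) + 1))) ∧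
    (initAvg h ≤ -δ →
      (erwLaw k p h).real (ConvergesTo x) ≤ C * Real.exp (-c * ((m : ℝ) + 1))))

/-- The attractor `x_+(p)` for `k = 3`; the other one is `x_-(p) = -x_+(p)`. -/
noncomputable def xPlus (p : ℝ) : ℝ := √(12 * p ^ 2 - 16 * p + 5) / (2 * p - 1)

/-- The root `y_+(p)` for `k = 3`. -/
noncomputable def yPlus (p : ℝ) : ℝ :=
  1 / 2 + √(12 * p ^ 2 - 16 * p + 5) / (2 * (2 * p - 1))

/-- The root `y_-(p)` for `k = 3`. -/
noncomputable def yMinus (p : ℝ) : ℝ :=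
  1 / 2 - √(12 * p ^ 2 - 16 * p + 5) / (2 * (2 * p - 1))

/-!
Write `y = 1 / 2 + u`, `k = 2 r + 1` and let `Q` (`centeredMaj`) be the majority polynomial recentred
at `1 / 2`. The urn function is `1 / 2 + (2 p - 1) Q u`, and `Q` is odd with derivative a constant
times `(1 / 4 - u ^ 2) ^ r`, because the derivatives of the Bernstein polynomials telescope
(`hasDerivAt_majorityProb`). So `Q` is increasing, and on `[0, 1 / 2]` it lies below its tangent at
`0`, of slope `maxSlope r`, and is strictly concave if `r > 0`. The phases are separated by the value
of `p` at which `(2 p - 1) * maxSlope r = 1`: below it only `u = 0` solves `(2 p - 1) Q u = u`, above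
it there are exactly three solutions `-v, 0, v`.

Given the past, the next step is positive with probability the urn function of the fraction of
positive steps (`nextStep_true`), so the average step is a stochastic approximation of the flow of
`drift x - x`. Four facts about the walk give the theorem.

* The accumulated noise is a martingale bounded in `L²`, hence converges. Once it is removed, the
  average step moves deterministically, cannot oscillate around a point that is not an equilibrium,
  and cannot converge to one: it converges almost surely to an equilibrium
  (`ae_exists_equilibrium`).
* If `0` is unstable, the average step does not converge to it (`ae_not_convergesTo_zero`). The
  function `potential` is bounded above and its conditional mean grows by a multiple of `1 / n` in
  each step taken near `0`; since the harmonic series diverges, the walk almost surely leaves every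
  small neighbourhood of `0` after any given time.
* In the two-attractor phase, for every level `α` in `(0, 2 v)` the mean step is larger than some
  `γ > α` as long as the average step is at least `α`, by monotonicity of `Q`. An exponential
  supermartingale bounds the probability of ever falling below `α`, which is needed to reach the
  opposite attractor (`exists_exp_bound`).
* If `0 < p < 1` both steps always have positive probability, so the walk may first move far to
  either side; the exponential bound, which is then less than one, shows that it has a chance of
  staying there (`erwLaw_real_pos_of_majority`).

Bounds on probabilities of events up to a finite horizon are proved by induction on the horizon,
conditioning on the first step (`erwLaw_real_eq_add`).
-/

/-! ### The law of one step -/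

/-- The sum of the steps of a history. -/
noncomputable def histSum {m : ℕ} (h : Finset.Iic m → Bool) : ℝ := ∑ t, (stepVal (h t) : ℝ)

/-- The position of the walk after `N` steps. -/
noncomputable def walk (X : ℕ → Bool) (N : ℕ) : ℝ := ∑ t ∈ Finset.range N, (stepVal (X t) : ℝ)

/-- The conditional mean of the next step when the average step is `x`. -/
noncomputable def drift (k : ℕ) (p x : ℝ) : ℝ := 2 * urnFun k p ((1 + x) / 2) - 1

/-- The history `h` followed by the step `b`. -/
def snocHist {m : ℕ} (h : Finset.Iic m → Bool) (b : Bool) : Finset.Iic (m + 1) → Bool :=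
  fun t => if ht : t.1 ≤ m then h ⟨t.1, Finset.mem_Iic.2 ht⟩ else b

lemma majority_eq_decide {k : ℕ} (hk : Odd k) (s : Fin k → Bool) :
    majority s = decide ((k + 1) / 2 ≤ (Finset.univ.filter fun j => s j = true).card) := by
  have h1 : ∑ j, stepVal (s j) = 2 * ((Finset.univ.filter fun j => s j = true).card : ℤ) - k := by
    have : ∀ j, stepVal (s j) = 2 * (if s j = true then 1 else 0) - 1 := by
      intro j; cases s j <;> simp [stepVal]
    simp_rw [this, Finset.sum_sub_distrib, ← Finset.mul_sum, Finset.sum_boole]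
    simp
  unfold majority
  rw [h1, decide_eq_decide]
  obtain ⟨r, rfl⟩ := hk
  omega

/-- The number of extractions `i` for which the positive draws are exactly those in `s`. -/
lemma card_extractions_eq {ι : Type*} [Fintype ι] [DecidableEq ι] {k : ℕ} (h : ι → Bool)
    (s : Finset (Fin k)) :
    (Finset.univ.filter fun i : Fin k → ι => (Finset.univ.filter fun j => h (i j) = true) = s).card
      = (Finset.univ.filter fun t => h t = true).card ^ s.card *
        (Finset.univ.filter fun t => h t = false).card ^ (k - s.card) := by
  have : (Finset.univ.filter fun i : Fin k → ι =>
      (Finset.univ.filter fun j => h (i j) = true) = s) =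
      Fintype.piFinset fun j => Finset.univ.filter fun t => h t = decide (j ∈ s) := by
    ext i
    simp only [Finset.mem_filter, Finset.mem_univ, true_and, Fintype.mem_piFinset,
      Finset.ext_iff]
    refine forall_congr' fun j => ?_
    by_cases hj : j ∈ s <;> simp [hj]
  rw [this, Fintype.card_piFinset, ← Finset.prod_mul_prod_compl s]
  rw [Finset.prod_congr rfl (g := fun _ => (Finset.univ.filter fun t => h t = true).card)
      (fun j hj => by simp [hj]),
    Finset.prod_congr (s₁ := sᶜ) rfl
      (g := fun _ => (Finset.univ.filter fun t => h t = false).card)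
      (fun j hj => by simp [Finset.mem_compl.1 hj])]
  simp [Finset.card_compl]

/-- Among `k` independent uniform draws from `ι`, a positive majority has probability
`majorityProb k y`, where `y` is the fraction of positive elements of `ι`. -/
lemma card_majority_true {ι : Type*} [Fintype ι] [Nonempty ι] {k : ℕ} (hk : Odd k) (h : ι → Bool) :
    ((Finset.univ.filter fun i : Fin k → ι => majority (fun j => h (i j)) = true).card : ℝ)
      / (Fintype.card ι : ℝ) ^ k =
    majorityProb k ((Finset.univ.filter fun t => h t = true).card / (Fintype.card ι : ℝ)) := by
  classical
  set a := (Finset.univ.filter fun t => h t = true).card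
  set b := (Finset.univ.filter fun t => h t = false).card
  have hab : (Fintype.card ι : ℝ) = a + b := by
    have := Finset.card_filter_add_card_filter_not (s := (Finset.univ : Finset ι))
      (fun t => h t = true)
    simp only [Bool.not_eq_true, Finset.card_univ] at this
    rw [← this]; push_cast; rfl
  have h0 : (Fintype.card ι : ℝ) ≠ 0 := by exact_mod_cast Fintype.card_ne_zero
  have hcount : (Finset.univ.filter fun i : Fin k → ι => majority (fun j => h (i j)) = true).card
      = ∑ n ∈ Finset.Icc ((k + 1) / 2) k, k.choose n * (a ^ n * b ^ (k - n)) := by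
    have h1 : ∀ i ∈ (Finset.univ.filter fun i : Fin k → ι => majority (fun j => h (i j)) = true),
        (Finset.univ.filter fun j => h (i j) = true) ∈
          (Finset.univ : Finset (Finset (Fin k))).filter (fun s => (k + 1) / 2 ≤ s.card) := by
      intro i hi
      simpa [majority_eq_decide hk] using hi
    rw [Finset.card_eq_sum_card_fiberwise h1]
    have h2 : ∀ s ∈ (Finset.univ : Finset (Finset (Fin k))).filter (fun s => (k + 1) / 2 ≤ s.card),
        ((Finset.univ.filter fun i : Fin k → ι => majority (fun j => h (i j)) = true).filter
          fun i => (Finset.univ.filter fun j => h (i j) = true) = s).card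
          = a ^ s.card * b ^ (k - s.card) := by
      intro s hs
      rw [← card_extractions_eq h s, Finset.filter_filter]
      congr 1
      ext i
      simp only [majority_eq_decide hk, Finset.mem_filter, Finset.mem_univ, true_and,
        decide_eq_true_eq] at hs ⊢
      constructor
      · exact fun hi => hi.2
      · rintro hi
        exact ⟨hi ▸ hs, hi⟩
    rw [Finset.sum_congr rfl h2]
    have h3 : ∀ s ∈ (Finset.univ : Finset (Finset (Fin k))).filter (fun s => (k + 1) / 2 ≤ s.card),
        s.card ∈ Finset.Icc ((k + 1) / 2) k := by
      intro s hs
      have := Finset.card_le_univ s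
      simp at hs this ⊢
      omega
    rw [← Finset.sum_fiberwise_of_maps_to h3]
    refine Finset.sum_congr rfl fun n hn => ?_
    rw [Finset.sum_congr rfl (g := fun _ => a ^ n * b ^ (k - n))
      (fun s hs => by rw [(Finset.mem_filter.1 hs).2]), Finset.sum_const, smul_eq_mul]
    congr 1
    rw [Finset.filter_filter]
    have : (Finset.univ.filter fun s : Finset (Fin k) => (k + 1) / 2 ≤ s.card ∧ s.card = n) =
        Finset.powersetCard n Finset.univ := by
      ext s
      simp only [Finset.mem_Icc, Finset.mem_filter, Finset.mem_univ, true_and,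
        Finset.mem_powersetCard, Finset.subset_univ] at hn ⊢
      omega
    rw [this, Finset.card_powersetCard, Finset.card_univ, Fintype.card_fin]
  rw [hcount, majorityProb]
  push_cast
  rw [Finset.sum_div]
  refine Finset.sum_congr rfl fun n hn => ?_
  have hn := (Finset.mem_Icc.1 hn).2
  have : 1 - (a : ℝ) / Fintype.card ι = b / Fintype.card ι := by
    field_simp; linarith
  rw [this, div_pow, div_pow]
  have h4 : (Fintype.card ι : ℝ) ^ k = (Fintype.card ι : ℝ) ^ n * (Fintype.card ι : ℝ) ^ (k - n) := by
    rw [← pow_add]; congr 1; omega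
  rw [h4]
  field_simp

lemma histSum_eq {m : ℕ} (h : Finset.Iic m → Bool) :
    histSum h = 2 * (Finset.univ.filter fun t => h t = true).card - (m + 1) := by
  have : ∀ t, (stepVal (h t) : ℝ) = 2 * (if h t = true then 1 else 0) - 1 := by
    intro t; cases h t <;> norm_num [stepVal]
  unfold histSum
  simp_rw [this, Finset.sum_sub_distrib, ← Finset.mul_sum, Finset.sum_boole]
  simp

lemma initAvg_eq {m : ℕ} (h : Finset.Iic m → Bool) : initAvg h = histSum h / (m + 1) := rfl

/-- The next step is positive with probability `π_k` of the fraction of positive steps. -/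
lemma nextStep_true {k : ℕ} (hk : Odd k) (p : unitInterval) {m : ℕ} (h : Finset.Iic m → Bool) :
    (nextStep k p h true).toReal = urnFun k p ((1 + initAvg h) / 2) := by
  have : Nonempty (Finset.Iic m) := ⟨⟨m, Finset.mem_Iic.2 le_rfl⟩⟩
  have hp0 := p.2.1
  have hp1 := p.2.2
  have hy : (1 + initAvg h) / 2 =
      (Finset.univ.filter fun t => h t = true).card / (Fintype.card (Finset.Iic m) : ℝ) := by
    rw [initAvg_eq, histSum_eq]
    simp only [Fintype.card_coe, Nat.card_Iic]
    push_cast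
    field_simp
    ring
  have hb : ∀ (q : Bool), ((bernoulliMeasure true false p).toPMF.map
      fun c => if c then q else !q) true = ENNReal.ofReal (if q then (p : ℝ) else 1 - p) := by
    intro q
    have h1 := bernoulliMeasure_apply (x := true) (y := false) p (s := {true}) (by measurability)
    have h2 := bernoulliMeasure_apply (x := true) (y := false) p (s := {false}) (by measurability)
    rw [PMF.map_apply, tsum_bool, Measure.toPMF_apply, Measure.toPMF_apply, h1, h2]
    cases q
    · simp only [Set.mem_singleton_iff, Bool.false_eq_true, if_false, Bool.true_eq_false, if_true,
        Bool.not_false, add_zero]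
      rw [ENNReal.ofReal]
      congr 1
      exact NNReal.eq (by simp [hp1])
    · simp only [Set.mem_singleton_iff, Bool.false_eq_true, if_false, Bool.true_eq_false, if_true,
        Bool.not_true, zero_add]
      rw [ENNReal.ofReal]
      congr 1
      exact NNReal.eq (by simp [hp0])
  set N := (Finset.univ.filter fun i : Fin k → Finset.Iic m =>
    majority (fun j => h (i j)) = true).card with hN
  have hc : (Fintype.card (Finset.Iic m) : ℝ) ^ k ≠ 0 :=
    pow_ne_zero _ (by exact_mod_cast Fintype.card_ne_zero)
  rw [hy, urnFun, ← card_majority_true hk h, nextStep, PMF.bind_apply, tsum_fintype,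
    ENNReal.toReal_sum]
  · simp only [hb, PMF.uniformOfFintype_apply, ENNReal.toReal_mul, ENNReal.toReal_inv]
    rw [← Finset.mul_sum]
    have h3 : ∀ i : Fin k → Finset.Iic m, (ENNReal.ofReal
        (if majority (fun j => h (i j)) = true then (p : ℝ) else 1 - p)).toReal =
        (2 * p - 1) * (if majority (fun j => h (i j)) = true then 1 else 0) + (1 - p) := by
      intro i
      rw [ENNReal.toReal_ofReal (by split_ifs <;> linarith)]
      split_ifs <;> ring
    simp_rw [h3, Finset.sum_add_distrib, ← Finset.mul_sum, Finset.sum_boole, ← hN]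
    simp only [ENNReal.toReal_pow, ENNReal.toReal_natCast, Fintype.card_pi, Finset.prod_const, Finset.card_univ,
      Fintype.card_fin, Finset.sum_const, nsmul_eq_mul, Nat.cast_pow] at hc ⊢
    field_simp
    ring
  · intro i _
    exact ENNReal.mul_ne_top (PMF.apply_ne_top _ _) (PMF.apply_ne_top _ _)

lemma erwKernel_real_true {k : ℕ} (hk : Odd k) (p : unitInterval) {m : ℕ}
    (h : Finset.Iic m → Bool) :
    (erwKernel k p m h).real {true} = urnFun k p ((1 + initAvg h) / 2) := by
  rw [← nextStep_true hk, measureReal_def]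
  congr 1
  exact PMF.toMeasure_apply_singleton _ _ (by measurability)

lemma erwKernel_real_false {k : ℕ} (hk : Odd k) (p : unitInterval) {m : ℕ}
    (h : Finset.Iic m → Bool) :
    (erwKernel k p m h).real {false} = 1 - urnFun k p ((1 + initAvg h) / 2) := by
  rw [← erwKernel_real_true hk, ← probReal_compl_eq_one_sub (by measurability)]
  congr 1
  ext b; cases b <;> simp

lemma urnFun_initAvg_mem {k : ℕ} (hk : Odd k) (p : unitInterval) {m : ℕ}
    (h : Finset.Iic m → Bool) : urnFun k p ((1 + initAvg h) / 2) ∈ Set.Icc (0 : ℝ) 1 := by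
  rw [← erwKernel_real_true hk]
  exact ⟨measureReal_nonneg, measureReal_le_one⟩

/-! ### Histories and trajectories -/

instance (k : ℕ) (p : unitInterval) {m : ℕ} (h : Finset.Iic m → Bool) :
    IsProbabilityMeasure (erwLaw k p h) := by
  unfold erwLaw; infer_instance

lemma partialTraj_erwKernel (k : ℕ) (p : unitInterval) {m : ℕ} (h : Finset.Iic m → Bool) :
    Kernel.partialTraj (X := fun _ => Bool) (erwKernel k p) m (m + 1) h =
      (erwKernel k p m h).map (snocHist h) := by
  have hs : snocHist h = IicProdIoc (X := fun _ => Bool) m (m + 1) ∘ Prod.mk h ∘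
      (MeasurableEquiv.piSingleton (X := fun _ => Bool) m) := by
    funext b t
    simp only [snocHist, IicProdIoc_def, Function.comp]
    split_ifs
    · rfl
    · simp [MeasurableEquiv.piSingleton]
  rw [Kernel.partialTraj_succ_self, Kernel.map_apply _ (by fun_prop), Kernel.prod_apply,
    Kernel.id_apply, Kernel.map_apply _ (by fun_prop), Measure.dirac_prod,
    Measure.map_map (by fun_prop) (by fun_prop), Measure.map_map (by fun_prop) (by fun_prop), hs]
  rfl

/-- Conditioning on the first step after the initial history. -/
lemma erwLaw_real_eq_add {k : ℕ} (hk : Odd k) (p : unitInterval) {m : ℕ} (h : Finset.Iic m → Bool)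
    {A : Set (ℕ → Bool)} (hA : MeasurableSet A) :
    (erwLaw k p h).real A =
      urnFun k p ((1 + initAvg h) / 2) * (erwLaw k p (snocHist h true)).real A +
      (1 - urnFun k p ((1 + initAvg h) / 2)) * (erwLaw k p (snocHist h false)).real A := by
  rw [← erwKernel_real_false hk, ← erwKernel_real_true hk]
  have h1 : erwLaw k p h A = ∑ b : Bool, erwLaw k p (snocHist h b) A * erwKernel k p m h {b} := by
    have h2 := Kernel.traj_comp_partialTraj (X := fun _ => Bool) (κ := erwKernel k p) (Nat.le_succ m)
    unfold erwLaw
    rw [← h2, Kernel.comp_apply' _ _ _ hA, Nat.succ_eq_add_one, partialTraj_erwKernel,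
      lintegral_map (Kernel.measurable_coe _ hA) (by fun_prop), lintegral_fintype]
  simp only [measureReal_def]
  rw [h1, Fintype.sum_bool, ENNReal.toReal_add (by finiteness) (by finiteness),
    ENNReal.toReal_mul, ENNReal.toReal_mul]
  ring

lemma ae_extends (k : ℕ) (p : unitInterval) {m : ℕ} (h : Finset.Iic m → Bool) :
    ∀ᵐ X ∂erwLaw k p h, ∀ t (ht : t ≤ m), X t = h ⟨t, Finset.mem_Iic.2 ht⟩ := by
  have h1 := Kernel.traj_map_frestrictLe_apply (X := fun _ => Bool) (κ := erwKernel k p) m m h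
  rw [Kernel.partialTraj_self, Kernel.id_apply] at h1
  have h2 : ∀ᵐ g ∂Measure.dirac h, g = h := by
    rw [ae_dirac_eq]; exact rfl
  rw [← h1] at h2
  filter_upwards [ae_of_ae_map (by fun_prop) h2] with X hX t ht
  rw [← hX]; rfl

lemma histSum_eq_walk {m : ℕ} (h : Finset.Iic m → Bool) {X : ℕ → Bool}
    (hX : ∀ t (ht : t ≤ m), X t = h ⟨t, Finset.mem_Iic.2 ht⟩) : histSum h = walk X (m + 1) := by
  have : Finset.range (m + 1) = Finset.Iic m := by ext; simp
  unfold histSum walk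
  rw [this, ← Finset.sum_coe_sort (Finset.Iic m)]
  exact Finset.sum_congr rfl fun t _ => by rw [hX t (Finset.mem_Iic.1 t.2)]

lemma ae_walk_eq (k : ℕ) (p : unitInterval) {m : ℕ} (h : Finset.Iic m → Bool) :
    ∀ᵐ X ∂erwLaw k p h, walk X (m + 1) = histSum h := by
  filter_upwards [ae_extends k p h] with X hX using (histSum_eq_walk h hX).symm

lemma walk_succ (X : ℕ → Bool) (N : ℕ) : walk X (N + 1) = walk X N + stepVal (X N) :=
  Finset.sum_range_succ _ _

lemma histSum_snocHist {m : ℕ} (h : Finset.Iic m → Bool) (b : Bool) :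
    histSum (snocHist h b) = histSum h + stepVal b := by
  let X : ℕ → Bool := fun t => if ht : t ≤ m then h ⟨t, Finset.mem_Iic.2 ht⟩ else b
  rw [histSum_eq_walk (snocHist h b) (X := X) (fun t _ => rfl),
    histSum_eq_walk h (X := X) (fun t ht => by simp [X, ht]), walk_succ]
  simp [X]

lemma avgStep_eq (X : ℕ → Bool) (N : ℕ) : avgStep X N = walk X N / N := rfl

lemma abs_stepVal (b : Bool) : |(stepVal b : ℝ)| = 1 := by cases b <;> simp [stepVal]

lemma abs_walk_le (X : ℕ → Bool) (N : ℕ) : |walk X N| ≤ N := by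
  refine (Finset.abs_sum_le_sum_abs _ _).trans ?_
  simp [abs_stepVal]

lemma abs_avgStep_le (X : ℕ → Bool) (N : ℕ) : |avgStep X N| ≤ 1 := by
  rw [avgStep_eq, abs_div, Nat.abs_cast]
  exact div_le_one_of_le₀ (abs_walk_le X N) (Nat.cast_nonneg N)

lemma abs_histSum_le {m : ℕ} (h : Finset.Iic m → Bool) : |histSum h| ≤ (m : ℝ) + 1 := by
  rw [histSum_eq_walk h
    (X := fun t => if ht : t ≤ m then h ⟨t, Finset.mem_Iic.2 ht⟩ else false)
    (fun t ht => by simp [ht])]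
  exact_mod_cast abs_walk_le _ _

@[fun_prop]
lemma measurable_stepVal_apply (t : ℕ) :
    Measurable fun X : ℕ → Bool => (stepVal (X t) : ℝ) :=
  (measurable_from_top (f := fun b : Bool => (stepVal b : ℝ))).comp (measurable_pi_apply t)

@[fun_prop]
lemma measurable_walk (N : ℕ) : Measurable fun X => walk X N := by
  unfold walk; fun_prop

@[fun_prop]
lemma measurable_avgStep (N : ℕ) : Measurable fun X => avgStep X N := by
  unfold avgStep; fun_prop

lemma measurableSet_convergesTo (x : ℝ) : MeasurableSet (ConvergesTo x) :=
  measurableSet_tendsto _ fun N => measurable_avgStep N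

/-! ### The majority polynomial -/

lemma majorityProb_eq_eval (k : ℕ) (y : ℝ) :
    majorityProb k y = (∑ h ∈ Finset.Icc ((k + 1) / 2) k, bernsteinPolynomial ℝ k h).eval y := by
  rw [Polynomial.eval_finsetSum]
  simp [majorityProb, bernsteinPolynomial]

/-- The derivatives of the Bernstein polynomials telescope. -/
lemma hasDerivAt_majorityProb (r : ℕ) (y : ℝ) :
    HasDerivAt (majorityProb (2 * r + 1))
      ((2 * r + 1) * (2 * r).choose r * (y * (1 - y)) ^ r) y := by
  have h1 : majorityProb (2 * r + 1) = fun y =>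
      (∑ h ∈ Finset.Icc ((2 * r + 1 + 1) / 2) (2 * r + 1),
        bernsteinPolynomial ℝ (2 * r + 1) h).eval y := by
    funext y; exact majorityProb_eq_eval _ y
  rw [h1]
  refine (Polynomial.hasDerivAt _ y).congr_deriv ?_
  have h2 : Finset.Icc ((2 * r + 1 + 1) / 2) (2 * r + 1) = Finset.Ico (r + 1) (2 * r + 1 + 1) := by
    ext; simp only [Finset.mem_Icc, Finset.mem_Ico]; omega
  rw [h2, Polynomial.derivative_sum, Finset.sum_Ico_eq_sum_range]
  have h3 : ∀ i ∈ Finset.range (2 * r + 1 + 1 - (r + 1)),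
      Polynomial.derivative (bernsteinPolynomial ℝ (2 * r + 1) (r + 1 + i)) =
      ((2 * r : ℕ) + 1) * (bernsteinPolynomial ℝ (2 * r) (r + i) -
        bernsteinPolynomial ℝ (2 * r) (r + (i + 1))) := by
    intro i _
    rw [show r + 1 + i = r + i + 1 by ring, bernsteinPolynomial.derivative_succ_aux, ← add_assoc]
  -- the sum telescopes to its first term, of degree `2 r` and index `r`
  rw [Finset.sum_congr rfl h3, ← Finset.mul_sum,
    Finset.sum_range_sub' (fun i => bernsteinPolynomial ℝ (2 * r) (r + i)),
    bernsteinPolynomial.eq_zero_of_lt ℝ (by omega : 2 * r < r + (2 * r + 1 + 1 - (r + 1)))]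
  have : 2 * r - r = r := by omega
  simp only [add_zero, sub_zero, bernsteinPolynomial, Polynomial.eval_mul, Polynomial.eval_add,
    Polynomial.eval_natCast, Polynomial.eval_one, Polynomial.eval_pow, Polynomial.eval_X,
    Polynomial.eval_sub, this, mul_pow]
  push_cast
  ring

lemma majorityProb_zero (r : ℕ) : majorityProb (2 * r + 1) 0 = 0 := by
  unfold majorityProb
  refine Finset.sum_eq_zero fun h hh => ?_
  have := (Finset.mem_Icc.1 hh).1
  rw [zero_pow (by omega)]
  simp

lemma majorityProb_one (r : ℕ) : majorityProb (2 * r + 1) 1 = 1 := by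
  unfold majorityProb
  rw [Finset.sum_eq_single (2 * r + 1)]
  · simp
  · intro h hh hne
    have := (Finset.mem_Icc.1 hh).2
    rw [sub_self, zero_pow (by omega), mul_zero]
  · intro h
    exact absurd (Finset.mem_Icc.2 ⟨by omega, le_rfl⟩) h

lemma majorityProb_one_sub (r : ℕ) (y : ℝ) :
    majorityProb (2 * r + 1) (1 - y) = 1 - majorityProb (2 * r + 1) y := by
  have hd : ∀ y : ℝ, HasDerivAt
      (fun y => majorityProb (2 * r + 1) (1 - y) + majorityProb (2 * r + 1) y) 0 y := by
    intro y
    have h1 := (hasDerivAt_majorityProb r (1 - y)).comp y ((hasDerivAt_id y).const_sub 1)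
    refine (h1.add (hasDerivAt_majorityProb r y)).congr_deriv ?_
    rw [sub_sub_cancel, mul_comm (1 - y)]
    ring
  have := is_const_of_deriv_eq_zero (fun y => (hd y).differentiableAt) (fun y => (hd y).deriv) y 0
  simp only [sub_zero, majorityProb_zero, majorityProb_one] at this
  linarith

/-- The majority polynomial for `2 r + 1` extractions, recentred at the fixed point `1 / 2`. -/
noncomputable def centeredMaj (r : ℕ) (u : ℝ) : ℝ := majorityProb (2 * r + 1) (1 / 2 + u) - 1 / 2

/-- The slope of the majority polynomial at `1 / 2`, which is its largest slope. -/
noncomputable def maxSlope (r : ℕ) : ℝ := (2 * r + 1) * (2 * r).choose r / 4 ^ r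

lemma urnFun_half_add (r : ℕ) (p u : ℝ) :
    urnFun (2 * r + 1) p (1 / 2 + u) = 1 / 2 + (2 * p - 1) * centeredMaj r u := by
  unfold urnFun centeredMaj; ring

lemma drift_eq (r : ℕ) (p x : ℝ) :
    drift (2 * r + 1) p x = 2 * ((2 * p - 1) * centeredMaj r (x / 2)) := by
  unfold drift
  rw [show (1 + x) / 2 = 1 / 2 + x / 2 by ring, urnFun_half_add]; ring

lemma hasDerivAt_centeredMaj (r : ℕ) (u : ℝ) :
    HasDerivAt (centeredMaj r) ((2 * r + 1) * (2 * r).choose r * (1 / 4 - u ^ 2) ^ r) u := by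
  have := ((hasDerivAt_majorityProb r (1 / 2 + u)).comp u
    ((hasDerivAt_id u).const_add (1 / 2))).sub_const (1 / 2)
  refine this.congr_deriv ?_
  rw [show (1 / 2 + u) * (1 - (1 / 2 + u)) = 1 / 4 - u ^ 2 by ring]
  ring

lemma continuous_centeredMaj (r : ℕ) : Continuous (centeredMaj r) :=
  continuous_iff_continuousAt.2 fun u => (hasDerivAt_centeredMaj r u).continuousAt

lemma continuous_drift (r : ℕ) (p : ℝ) : Continuous (drift (2 * r + 1) p) := by
  have := continuous_centeredMaj r
  rw [funext (drift_eq r p)]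
  fun_prop

lemma centeredMaj_neg (r : ℕ) (u : ℝ) : centeredMaj r (-u) = -centeredMaj r u := by
  unfold centeredMaj
  rw [show 1 / 2 + -u = 1 - (1 / 2 + u) by ring, majorityProb_one_sub]; ring

lemma centeredMaj_zero (r : ℕ) : centeredMaj r 0 = 0 := by
  have := centeredMaj_neg r 0
  rw [neg_zero] at this
  linarith

lemma centeredMaj_half (r : ℕ) : centeredMaj r (1 / 2) = 1 / 2 := by
  unfold centeredMaj
  rw [show (1 : ℝ) / 2 + 1 / 2 = 1 by norm_num, majorityProb_one]; norm_num

lemma leadingCoeff_pos (r : ℕ) : (0 : ℝ) < (2 * r + 1) * (2 * r).choose r := by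
  have : 0 < (2 * r).choose r := Nat.choose_pos (by omega)
  positivity

lemma hasDerivAt_centeredMaj_zero (r : ℕ) : HasDerivAt (centeredMaj r) (maxSlope r) 0 := by
  refine (hasDerivAt_centeredMaj r 0).congr_deriv ?_
  rw [maxSlope, div_eq_mul_one_div _ ((4 : ℝ) ^ r), ← one_div_pow]
  norm_num

lemma maxSlope_pos (r : ℕ) : 0 < maxSlope r := div_pos (leadingCoeff_pos r) (by positivity)

lemma one_lt_maxSlope {r : ℕ} (hr : 0 < r) : 1 < maxSlope r := by
  unfold maxSlope
  rw [one_lt_div (by positivity)]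
  have h1 := Nat.four_pow_le_two_mul_self_mul_centralBinom r hr
  have h2 := Nat.centralBinom_pos r
  rw [Nat.centralBinom_eq_two_mul_choose] at h1 h2
  have h3 : 4 ^ r < (2 * r + 1) * (2 * r).choose r := by
    rw [add_mul]; omega
  exact_mod_cast h3

lemma monotoneOn_centeredMaj (r : ℕ) : MonotoneOn (centeredMaj r) (Set.Icc (-(1 / 2)) (1 / 2)) := by
  refine monotoneOn_of_deriv_nonneg (convex_Icc _ _) (continuous_centeredMaj r).continuousOn
    (fun u _ => (hasDerivAt_centeredMaj r u).differentiableAt.differentiableWithinAt) ?_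
  intro u hu
  rw [interior_Icc] at hu
  rw [(hasDerivAt_centeredMaj r u).deriv]
  have : 0 ≤ 1 / 4 - u ^ 2 := by nlinarith [hu.1, hu.2]
  exact mul_nonneg (leadingCoeff_pos r).le (pow_nonneg this r)

lemma centeredMaj_nonneg (r : ℕ) {u : ℝ} (h0 : 0 ≤ u) (h1 : u ≤ 1 / 2) : 0 ≤ centeredMaj r u := by
  rw [← centeredMaj_zero r]
  exact monotoneOn_centeredMaj r ⟨by norm_num, by norm_num⟩ ⟨by linarith, h1⟩ h0

lemma centeredMaj_le (r : ℕ) {u : ℝ} (h0 : 0 ≤ u) (h1 : u ≤ 1 / 2) :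
    centeredMaj r u ≤ maxSlope r * u := by
  have := Convex.image_sub_le_mul_sub_of_deriv_le (convex_Icc (0 : ℝ) (1 / 2))
    (f := centeredMaj r) (C := maxSlope r) (continuous_centeredMaj r).continuousOn
    (fun u _ => (hasDerivAt_centeredMaj r u).differentiableAt.differentiableWithinAt)
    (fun v hv => by
      rw [interior_Icc] at hv
      rw [(hasDerivAt_centeredMaj r v).deriv, maxSlope,
        div_eq_mul_one_div _ ((4 : ℝ) ^ r), ← one_div_pow]
      have h2 : 0 ≤ 1 / 4 - v ^ 2 := by nlinarith [hv.1, hv.2]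
      refine mul_le_mul_of_nonneg_left (pow_le_pow_left₀ h2 ?_ r) (leadingCoeff_pos r).le
      nlinarith [sq_nonneg v])
    0 ⟨le_rfl, by norm_num⟩ u ⟨h0, h1⟩ h0
  rw [centeredMaj_zero] at this
  linarith

lemma deriv_centeredMaj_strictAntiOn {r : ℕ} (hr : 0 < r) :
    StrictAntiOn (fun u : ℝ => (2 * r + 1) * (2 * r).choose r * (1 / 4 - u ^ 2) ^ r)
      (Set.Icc (0 : ℝ) (1 / 2)) := by
  intro u hu v hv huv
  refine mul_lt_mul_of_pos_left (pow_lt_pow_left₀ ?_ ?_ hr.ne') (leadingCoeff_pos r)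
  · nlinarith [hu.1]
  · nlinarith [hv.1, hv.2]

lemma strictConcaveOn_centeredMaj {r : ℕ} (hr : 0 < r) :
    StrictConcaveOn ℝ (Set.Icc (0 : ℝ) (1 / 2)) (centeredMaj r) := by
  refine StrictAntiOn.strictConcaveOn_of_deriv (convex_Icc _ _)
    (continuous_centeredMaj r).continuousOn ?_
  rw [funext fun u => (hasDerivAt_centeredMaj r u).deriv]
  exact (deriv_centeredMaj_strictAntiOn hr).mono interior_subset

/-! ### Equilibria of the urn function -/

lemma isDownCrossing_of_hasDerivAt {f : ℝ → ℝ} {y f' : ℝ} (hf : HasDerivAt f f' y) (h1 : f' < 1)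
    (hy : f y = y) : IsDownCrossing f y := by
  have h2 := (hasDerivAt_iff_tendsto_slope.1 hf).eventually (gt_mem_nhds h1)
  refine ⟨hy, ?_, ?_⟩
  · filter_upwards [h2.filter_mono (nhdsWithin_mono y fun z (hz : z < y) => hz.ne),
      self_mem_nhdsWithin] with z hz hzy
    have hzy : z - y < 0 := sub_neg.2 hzy
    rw [slope_def_field, hy, div_lt_one_of_neg hzy] at hz
    linarith
  · filter_upwards [h2.filter_mono (nhdsWithin_mono y fun z (hz : y < z) => hz.ne'),
      self_mem_nhdsWithin] with z hz hzy
    have hzy : 0 < z - y := sub_pos.2 hzy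
    rw [slope_def_field, hy, div_lt_one hzy] at hz
    linarith

lemma isUpCrossing_of_hasDerivAt {f : ℝ → ℝ} {y f' : ℝ} (hf : HasDerivAt f f' y) (h1 : 1 < f')
    (hy : f y = y) : IsUpCrossing f y := by
  have h2 := (hasDerivAt_iff_tendsto_slope.1 hf).eventually (lt_mem_nhds h1)
  refine ⟨hy, ?_, ?_⟩
  · filter_upwards [h2.filter_mono (nhdsWithin_mono y fun z (hz : z < y) => hz.ne),
      self_mem_nhdsWithin] with z hz hzy
    have hzy : z - y < 0 := sub_neg.2 hzy
    rw [slope_def_field, hy, one_lt_div_of_neg hzy] at hz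
    linarith
  · filter_upwards [h2.filter_mono (nhdsWithin_mono y fun z (hz : y < z) => hz.ne'),
      self_mem_nhdsWithin] with z hz hzy
    have hzy : 0 < z - y := sub_pos.2 hzy
    rw [slope_def_field, hy, one_lt_div hzy] at hz
    linarith

lemma hasDerivAt_urnFun (r : ℕ) (p u : ℝ) {c : ℝ} (hc : HasDerivAt (centeredMaj r) c u) :
    HasDerivAt (urnFun (2 * r + 1) p) ((2 * p - 1) * c) (1 / 2 + u) := by
  have h1 : urnFun (2 * r + 1) p = fun y => 1 / 2 + (2 * p - 1) * centeredMaj r (y - 1 / 2) := by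
    funext y
    rw [← urnFun_half_add]; congr 1; ring
  rw [h1]
  have h2 : HasDerivAt (fun y : ℝ => y - 1 / 2) 1 (1 / 2 + u) := (hasDerivAt_id _).sub_const _
  have h3 : HasDerivAt (centeredMaj r) c (1 / 2 + u - 1 / 2) := by simpa using hc
  simpa using ((h3.comp (1 / 2 + u) h2).const_mul (2 * p - 1)).const_add (1 / 2)

lemma subcritical_lt {r : ℕ} {q : ℝ} (hq : q * maxSlope r < 1) {u : ℝ} (h0 : 0 < u)
    (h1 : u ≤ 1 / 2) : q * centeredMaj r u < u := by
  have h2 := centeredMaj_nonneg r h0.le h1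
  have h3 := centeredMaj_le r h0.le h1
  rcases le_total q 0 with hq0 | hq0
  · nlinarith
  · nlinarith

lemma subcritical_fixed_iff {r : ℕ} {q : ℝ} (hq : q * maxSlope r < 1) {u : ℝ}
    (hu : u ∈ Set.Icc (-(1 / 2) : ℝ) (1 / 2)) : q * centeredMaj r u = u ↔ u = 0 := by
  constructor
  · intro h
    by_contra hne
    rcases lt_or_gt_of_ne hne with h0 | h0
    · have := subcritical_lt hq (neg_pos.2 h0) (by linarith [hu.1])
      rw [centeredMaj_neg] at this
      linarith
    · have := subcritical_lt hq h0 hu.2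
      linarith
  · rintro rfl
    rw [centeredMaj_zero, mul_zero]

lemma lt_of_lt_fixed (hr : 0 < r) {q v : ℝ} (hq : 0 < q) (hv1 : v ≤ 1 / 2)
    (hv : q * centeredMaj r v = v) {u : ℝ} (h0 : 0 < u) (h1 : u < v) :
    u < q * centeredMaj r u := by
  have hv0 : 0 < v := h0.trans h1
  have h2 := (strictConcaveOn_centeredMaj hr).2 (Set.left_mem_Icc.2 (by norm_num))
    (Set.mem_Icc.2 ⟨hv0.le, hv1⟩) hv0.ne
    (show 0 < 1 - u / v by rw [sub_pos, div_lt_one hv0]; exact h1)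
    (show 0 < u / v by positivity) (by ring)
  simp only [smul_eq_mul, mul_zero, zero_add, centeredMaj_zero, div_mul_cancel₀ u hv0.ne'] at h2
  have h3 : q * (u / v * centeredMaj r v) = u := by
    rw [mul_left_comm, hv, div_mul_cancel₀ u hv0.ne']
  calc u = q * (u / v * centeredMaj r v) := h3.symm
    _ < _ := mul_lt_mul_of_pos_left h2 hq

lemma lt_of_fixed_lt (hr : 0 < r) {q v : ℝ} (hq : 0 < q) (hv0 : 0 < v)
    (hv : q * centeredMaj r v = v) {u : ℝ} (h0 : v < u) (h1 : u ≤ 1 / 2) :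
    q * centeredMaj r u < u := by
  have hu0 : 0 < u := hv0.trans h0
  have h2 := (strictConcaveOn_centeredMaj hr).2 (Set.left_mem_Icc.2 (by norm_num))
    (Set.mem_Icc.2 ⟨hu0.le, h1⟩) hu0.ne
    (show 0 < 1 - v / u by rw [sub_pos, div_lt_one hu0]; exact h0)
    (show 0 < v / u by positivity) (by ring)
  simp only [smul_eq_mul, mul_zero, zero_add, centeredMaj_zero, div_mul_cancel₀ v hu0.ne'] at h2
  have h3 := mul_lt_mul_of_pos_left h2 hq
  rw [hv, mul_left_comm, div_mul_eq_mul_div, div_lt_iff₀ hu0] at h3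
  exact lt_of_mul_lt_mul_left h3 hv0.le

lemma supercritical_fixed_iff (hr : 0 < r) {q v : ℝ} (hq : 0 < q) (hv0 : 0 < v) (hv1 : v ≤ 1 / 2)
    (hv : q * centeredMaj r v = v) {u : ℝ} (hu : u ∈ Set.Icc (-(1 / 2) : ℝ) (1 / 2)) :
    q * centeredMaj r u = u ↔ u = -v ∨ u = 0 ∨ u = v := by
  have key : ∀ u : ℝ, 0 < u → u ≤ 1 / 2 → q * centeredMaj r u = u → u = v := by
    intro u h0 h1 h
    rcases lt_trichotomy u v with h2 | h2 | h2
    · linarith [lt_of_lt_fixed hr hq hv1 hv h0 h2]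
    · exact h2
    · linarith [lt_of_fixed_lt hr hq hv0 hv h2 h1]
  constructor
  · intro h
    rcases lt_trichotomy u 0 with h0 | h0 | h0
    · left
      have := key (-u) (by linarith) (by linarith [hu.1]) (by rw [centeredMaj_neg]; linarith)
      linarith
    · exact Or.inr (Or.inl h0)
    · exact Or.inr (Or.inr (key u h0 hu.2 h))
  · rintro (rfl | rfl | rfl)
    · rw [centeredMaj_neg]; linarith
    · rw [centeredMaj_zero, mul_zero]
    · exact hv

lemma slope_fixed_lt_one (hr : 0 < r) {q v : ℝ} (hq : 0 < q) (hv0 : 0 < v) (hv1 : v ≤ 1 / 2)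
    (hv : q * centeredMaj r v = v) :
    q * ((2 * r + 1) * (2 * r).choose r * (1 / 4 - v ^ 2) ^ r) < 1 := by
  obtain ⟨c, hc, hc'⟩ := exists_hasDerivAt_eq_slope (centeredMaj r) _ hv0
    (continuous_centeredMaj r).continuousOn (fun u _ => hasDerivAt_centeredMaj r u)
  have h1 := deriv_centeredMaj_strictAntiOn hr ⟨hc.1.le, hc.2.le.trans hv1⟩ ⟨hv0.le, hv1⟩ hc.2
  simp only [centeredMaj_zero, sub_zero] at h1 hc'
  rw [hc'] at h1
  calc _ < q * (centeredMaj r v / v) := mul_lt_mul_of_pos_left h1 hq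
    _ = 1 := by rw [← mul_div_assoc, hv, div_self hv0.ne']

/-- Near `1 / 2` a supercritical urn function is steeper than the diagonal. -/
lemma exists_supercritical_slope {r : ℕ} {q : ℝ} (hq : 1 < q * maxSlope r) :
    ∃ a ε : ℝ, 1 < a ∧ 0 < ε ∧ ∀ u, |u| ≤ ε → a * u ^ 2 ≤ u * (q * centeredMaj r u) := by
  obtain ⟨a, ha1, ha2⟩ := exists_between hq
  have h1 := (hasDerivAt_centeredMaj_zero r).const_mul q
  have h2 := (hasDerivAt_iff_tendsto_slope.1 h1).eventually (lt_mem_nhds ha2)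
  rw [eventually_nhdsWithin_iff, Metric.eventually_nhds_iff] at h2
  obtain ⟨ε, hε, h2⟩ := h2
  refine ⟨a, ε / 2, ha1, by positivity, fun u hu => ?_⟩
  rcases eq_or_ne u 0 with rfl | hu0
  · simp
  · have h3 := h2 (y := u) (by rw [Real.dist_eq, sub_zero]; linarith) hu0
    rw [slope_def_field, centeredMaj_zero, mul_zero, sub_zero, sub_zero] at h3
    calc a * u ^ 2 ≤ q * centeredMaj r u / u * u ^ 2 :=
          mul_le_mul_of_nonneg_right h3.le (sq_nonneg u)
      _ = _ := by field_simp

lemma exists_supercritical_fixed {r : ℕ} {q : ℝ} (hq1 : q ≤ 1) (hq : 1 < q * maxSlope r) :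
    ∃ v : ℝ, 0 < v ∧ v ≤ 1 / 2 ∧ q * centeredMaj r v = v := by
  obtain ⟨a, ε, ha, hε, h⟩ := exists_supercritical_slope hq
  set u := min ε (1 / 2) with hu
  have hu0 : 0 < u := lt_min hε (by norm_num)
  have h1 := h u (by rw [abs_of_pos hu0]; exact min_le_left _ _)
  have h2 : u ≤ q * centeredMaj r u := by
    have : u * u ≤ u * (q * centeredMaj r u) := by nlinarith
    exact le_of_mul_le_mul_left this hu0
  have hc : ContinuousOn (fun v => v - q * centeredMaj r v) (Set.Icc u (1 / 2)) := by
    have := continuous_centeredMaj r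
    fun_prop
  obtain ⟨v, hv, hv'⟩ := intermediate_value_Icc (min_le_right ε (1 / 2)) hc
    (show (0 : ℝ) ∈ _ from ⟨by linarith, by rw [centeredMaj_half]; linarith⟩)
  exact ⟨v, hu0.trans_le hv.1, hv.2, by simp only at hv'; linarith⟩

/-! ### Three extractions -/

lemma centeredMaj_three (u : ℝ) : centeredMaj 1 u = 3 / 2 * u - 2 * u ^ 3 := by
  unfold centeredMaj majorityProb
  have : Finset.Icc ((2 * 1 + 1 + 1) / 2) (2 * 1 + 1) = {2, 3} := by decide
  rw [this, Finset.sum_pair (by norm_num)]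
  norm_num [Nat.choose]
  ring

lemma maxSlope_one : maxSlope 1 = 3 / 2 := by
  norm_num [maxSlope, Nat.choose]

lemma urnFun_three_fixed_iff (p y : ℝ) : urnFun 3 p y = y ↔
    y - 1 / 2 = 0 ∨ 4 * (2 * p - 1) * (y - 1 / 2) ^ 2 = 6 * p - 5 := by
  have h : urnFun 3 p y = 1 / 2 + (2 * p - 1) * centeredMaj 1 (y - 1 / 2) := by
    rw [← urnFun_half_add, add_sub_cancel]
  rw [h, centeredMaj_three, ← sub_eq_zero (a := 4 * _ * _), ← mul_eq_zero]
  constructor <;> intro h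
  · linear_combination (-2) * h
  · linear_combination (-1 / 2) * h

/-! ### Stochastic approximation: the deterministic part -/

/-- A sequence with small increments which is eventually nondecreasing near `c` cannot cross `c`
downwards infinitely often. -/
lemma not_frequently_of_increasing_near {z : ℕ → ℝ} {a b c η : ℝ} (hη : 0 < η) (hac : a < c)
    (hcb : c < b) (hinc : ∀ᶠ n in atTop, |z (n + 1) - z n| ≤ η)
    (hup : ∀ᶠ n in atTop, |z n - c| ≤ η → z n ≤ z (n + 1)) :
    ¬((∃ᶠ n in atTop, z n < a) ∧ ∃ᶠ n in atTop, b < z n) := by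
  rintro ⟨h1, h2⟩
  obtain ⟨N, hN⟩ := eventually_atTop.1 (hinc.and hup)
  obtain ⟨n₀, hn₀, hb⟩ := frequently_atTop.1 h2 N
  have h3 : ∀ n, n₀ ≤ n → c ≤ z n := by
    intro n hn
    induction n, hn using Nat.le_induction with
    | base => linarith
    | succ n hn ih =>
      obtain ⟨h4, h5⟩ := hN n (hn₀.trans hn)
      by_cases h6 : z n ≤ c + η
      · linarith [h5 (abs_le.2 ⟨by linarith, by linarith⟩)]
      · linarith [(abs_le.1 h4).1]
  obtain ⟨n, hn, ha⟩ := frequently_atTop.1 h1 n₀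
  linarith [h3 n hn]

lemma tendsto_sum_one_div_add_atTop (m : ℕ) :
    Tendsto (fun d => ∑ i ∈ Finset.range d, 1 / (((i + m : ℕ) : ℝ) + 1)) atTop atTop := by
  rw [← not_summable_iff_tendsto_nat_atTop_of_nonneg (fun i => by positivity),
    summable_nat_add_iff (f := fun i : ℕ => 1 / ((i : ℝ) + 1)) m]
  exact_mod_cast mt (summable_nat_add_iff (f := fun i : ℕ => 1 / (i : ℝ)) 1).1
    Real.not_summable_one_div_natCast

/-- The increments of a convergent sequence cannot be eventually bounded below
by a positive multiple of `1 / (n + 2)`. -/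
lemma not_tendsto_of_harmonic_increments {z : ℕ → ℝ} {η ℓ : ℝ} (hη : 0 < η)
    (hup : ∀ᶠ n in atTop, z n + η / ((n : ℝ) + 2) ≤ z (n + 1)) : ¬Tendsto z atTop (𝓝 ℓ) := by
  intro hz
  obtain ⟨N, hN⟩ := eventually_atTop.1 hup
  have h1 : ∀ d : ℕ,
      z N + η * ∑ i ∈ Finset.range d, 1 / (((i + N + 1 : ℕ) : ℝ) + 1) ≤ z (N + d) := by
    intro d
    induction d with
    | zero => simp
    | succ d ih =>
      rw [Finset.sum_range_succ, mul_add]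
      have h2 := hN (N + d) (by omega)
      have h3 : η * (1 / (((d + N + 1 : ℕ) : ℝ) + 1)) = η / (((N + d : ℕ) : ℝ) + 2) := by
        push_cast; rw [mul_one_div]; congr 1; ring
      rw [← add_assoc N d 1]
      linarith
  have h3 := tendsto_atTop_add_const_left atTop (z N)
    ((tendsto_sum_one_div_add_atTop (N + 1)).const_mul_atTop hη)
  have h4 := tendsto_atTop_mono h1 h3
  have h5 : Tendsto (fun d => z (N + d)) atTop (𝓝 ℓ) := by
    simpa only [add_comm N] using (tendsto_add_atTop_iff_nat N).2 hz
  exact not_tendsto_atTop_of_tendsto_nhds h5 h4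

/-- A bounded sequence driven by a continuous field `F` with steps `1 / (n + 2)`, up to the
increments of a convergent sequence `M`, converges to a zero of `F`. -/
lemma exists_tendsto_zero_of_field {F : ℝ → ℝ} (hF : Continuous F) {x M : ℕ → ℝ} {L : ℝ}
    (hx : ∀ n, |x n| ≤ 1) (hzero : {c ∈ Set.Icc (-1 : ℝ) 1 | F c = 0}.Finite)
    (hM : Tendsto M atTop (𝓝 L))
    (hrec : ∀ᶠ n in atTop, x (n + 1) = x n + F (x n) / ((n : ℝ) + 2) + (M (n + 1) - M n)) :
    ∃ ℓ ∈ Set.Icc (-1 : ℝ) 1, F ℓ = 0 ∧ Tendsto x atTop (𝓝 ℓ) := by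
  set z : ℕ → ℝ := fun n => x n - (M n - L) with hz
  have hML : Tendsto (fun n => M n - L) atTop (𝓝 0) := by
    simpa using hM.sub_const L
  have hzrec : ∀ᶠ n in atTop, z (n + 1) = z n + F (x n) / ((n : ℝ) + 2) := by
    filter_upwards [hrec] with n hn
    simp only [hz, hn]; ring
  obtain ⟨B, hB⟩ := isCompact_Icc.exists_bound_of_continuousOn (s := Set.Icc (-1 : ℝ) 1)
    hF.continuousOn
  have hharm : Tendsto (fun n : ℕ => B / ((n : ℝ) + 2)) atTop (𝓝 0) :=
    tendsto_const_nhds.div_atTop (tendsto_atTop_add_const_right _ _ tendsto_natCast_atTop_atTop)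
  have hinc : ∀ η > 0, ∀ᶠ n in atTop, |z (n + 1) - z n| ≤ η := by
    intro η hη
    filter_upwards [hzrec, hharm.eventually (gt_mem_nhds hη)] with n hn hn'
    rw [hn, add_sub_cancel_left, abs_div, abs_of_pos (by positivity : (0 : ℝ) < (n : ℝ) + 2)]
    exact (div_le_div_of_nonneg_right (hB _ (abs_le.1 (hx n))) (by positivity)).trans hn'.le
  have hclose : ∀ η > 0, ∀ᶠ n in atTop, |x n - z n| ≤ η := by
    intro η hη
    filter_upwards [(Metric.tendsto_nhds.1 hML) η hη] with n hn
    rw [Real.dist_eq, sub_zero] at hn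
    simpa [hz] using hn.le
  -- near a point where the field is nonzero, the sequence moves in a definite direction
  have hfield : ∀ G : ℝ → ℝ, Continuous G → ∀ c, 0 < G c →
      ∃ η > 0, ∀ᶠ n in atTop, |z n - c| ≤ η → η ≤ G (x n) := by
    intro G hG c hc
    obtain ⟨η, hη, h⟩ := Metric.continuousAt_iff.1 hG.continuousAt (G c / 2) (half_pos hc)
    refine ⟨min (η / 3) (G c / 2), by positivity, ?_⟩
    filter_upwards [hclose (η / 3) (by positivity)] with n hn hzc
    have h1 : dist (x n) c < η := by
      rw [Real.dist_eq]
      calc |x n - c| = |(x n - z n) + (z n - c)| := by ring_nf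
        _ ≤ |x n - z n| + |z n - c| := abs_add_le _ _
        _ ≤ η / 3 + η / 3 := add_le_add hn (hzc.trans (min_le_left _ _))
        _ < η := by linarith
    have h2 := h h1
    rw [Real.dist_eq] at h2
    have := (abs_lt.1 h2).1
    exact (min_le_right _ _).trans (by linarith)
  have hzb : ∀ᶠ n in atTop, |z n| ≤ 2 := by
    filter_upwards [hclose 1 one_pos] with n hn
    have h1 := abs_le.1 hn
    have h2 := abs_le.1 (hx n)
    exact abs_le.2 ⟨by linarith, by linarith⟩
  have hconv : ∃ ℓ, Tendsto z atTop (𝓝 ℓ) := by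
    refine tendsto_of_no_upcrossings (s := Set.univ) dense_univ ?_
      ⟨2, hzb.mono fun n hn => (abs_le.1 hn).2⟩ ⟨-2, hzb.mono fun n hn => (abs_le.1 hn).1⟩
    intro a _ b _ hab hcross
    -- a crossed interval lies in `[-1, 1]`, so it contains a point where the field is nonzero
    have ha : -1 ≤ a := by
      by_contra! ha
      refine hcross.1 ?_
      filter_upwards [hclose (-1 - a) (by linarith)] with n hn
      linarith [(abs_le.1 hn).2, (abs_le.1 (hx n)).1]
    have hb : b ≤ 1 := by
      by_contra! hb
      refine hcross.2 ?_
      filter_upwards [hclose (b - 1) (by linarith)] with n hn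
      linarith [(abs_le.1 hn).1, (abs_le.1 (hx n)).2]
    obtain ⟨c, hc, hFc⟩ : ∃ c ∈ Set.Ioo a b, F c ≠ 0 := by
      by_contra! hall
      exact Set.Ioo_infinite hab (hzero.subset fun c hc =>
        ⟨⟨ha.trans hc.1.le, hc.2.le.trans hb⟩, hall c hc⟩)
    rcases lt_or_gt_of_ne hFc with h0 | h0
    · obtain ⟨η, hη, h⟩ := hfield (fun t => -F t) hF.neg c (by linarith)
      refine not_frequently_of_increasing_near (z := fun n => -z n) (a := -b) (b := -a) (c := -c)
        hη (by linarith [hc.2]) (by linarith [hc.1]) ?_ ?_ ⟨?_, ?_⟩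
      · filter_upwards [hinc η hη] with n hn
        rwa [← abs_neg, show -(-z (n + 1) - -z n) = z (n + 1) - z n by ring]
      · filter_upwards [h, hzrec] with n hn hn' hzc
        have h1 := hn (by rwa [← abs_neg, show -(z n - c) = -z n - -c by ring])
        rw [hn']
        have : 0 ≤ -F (x n) / ((n : ℝ) + 2) := div_nonneg (hη.le.trans h1) (by positivity)
        rw [neg_div] at this
        linarith
      · exact hcross.2.mono fun n hn => by linarith
      · exact hcross.1.mono fun n hn => by linarith
    · obtain ⟨η, hη, h⟩ := hfield F hF c h0
      refine not_frequently_of_increasing_near hη hc.1 hc.2 (hinc η hη) ?_ hcross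
      filter_upwards [h, hzrec] with n hn hn' hzc
      rw [hn']
      have : 0 ≤ F (x n) / ((n : ℝ) + 2) := div_nonneg (hη.le.trans (hn hzc)) (by positivity)
      linarith
  obtain ⟨ℓ, hℓ⟩ := hconv
  have hxℓ : Tendsto x atTop (𝓝 ℓ) := by
    have := hℓ.add hML
    simpa [hz] using this
  refine ⟨ℓ, isClosed_Icc.mem_of_tendsto hxℓ (Eventually.of_forall fun n => abs_le.1 (hx n)), ?_,
    hxℓ⟩
  by_contra hne
  rcases lt_or_gt_of_ne hne with h0 | h0
  · obtain ⟨η, hη, h⟩ := hfield (fun t => -F t) hF.neg ℓ (by linarith)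
    refine not_tendsto_of_harmonic_increments (z := fun n => -z n) (ℓ := -ℓ) hη ?_ hℓ.neg
    filter_upwards [h, hzrec, (Metric.tendsto_nhds.1 hℓ) η hη] with n hn hn' hd
    have := div_le_div_of_nonneg_right (hn hd.le) (by positivity : (0 : ℝ) ≤ (n : ℝ) + 2)
    rw [neg_div] at this
    rw [hn']; linarith
  · obtain ⟨η, hη, h⟩ := hfield F hF ℓ h0
    refine not_tendsto_of_harmonic_increments (z := z) hη ?_ hℓ
    filter_upwards [h, hzrec, (Metric.tendsto_nhds.1 hℓ) η hη] with n hn hn' hd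
    have := div_le_div_of_nonneg_right (hn hd.le) (by positivity : (0 : ℝ) ≤ (n : ℝ) + 2)
    rw [hn']; linarith

/-! ### Stochastic approximation: the noise -/

/-- The contribution to the average step of the deviation of the step numbered `j + 1` from its
conditional mean. -/
noncomputable def noise (k : ℕ) (p : ℝ) (j : ℕ) (X : ℕ → Bool) : ℝ :=
  (stepVal (X (j + 1)) - drift k p (avgStep X (j + 1))) / ((j : ℝ) + 2)

/-- The accumulated noise of the steps after time `m`. -/
noncomputable def noiseSum (k : ℕ) (p : ℝ) (m n : ℕ) (X : ℕ → Bool) : ℝ :=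
  ∑ j ∈ Finset.range n, if m ≤ j then noise k p j X else 0

lemma noiseSum_succ (k : ℕ) (p : ℝ) (m n : ℕ) (X : ℕ → Bool) :
    noiseSum k p m (n + 1) X = noiseSum k p m n X + if m ≤ n then noise k p n X else 0 :=
  Finset.sum_range_succ _ _

lemma avgStep_succ (k : ℕ) (p : ℝ) (X : ℕ → Bool) (j : ℕ) :
    avgStep X (j + 1 + 1) = avgStep X (j + 1) +
      (drift k p (avgStep X (j + 1)) - avgStep X (j + 1)) / ((j : ℝ) + 2) + noise k p j X := by
  unfold noise
  have h1 : walk X (j + 1) = ((j : ℝ) + 1) * avgStep X (j + 1) := by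
    rw [avgStep_eq]; push_cast; field_simp
  rw [avgStep_eq X (j + 1 + 1), walk_succ, h1]
  push_cast
  field_simp
  ring

lemma avgStep_eq_initAvg (X : ℕ → Bool) (j : ℕ) :
    avgStep X (j + 1) = initAvg (Preorder.frestrictLe (π := fun _ => Bool) j X) := by
  rw [initAvg_eq, histSum_eq_walk _ (X := X) (fun t ht => rfl), avgStep_eq]
  push_cast; rfl

lemma abs_drift_le {k : ℕ} (hk : Odd k) (p : unitInterval) (X : ℕ → Bool) (j : ℕ) :
    |drift k p (avgStep X (j + 1))| ≤ 1 := by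
  rw [avgStep_eq_initAvg, drift, abs_le]
  have := urnFun_initAvg_mem hk p (Preorder.frestrictLe (π := fun _ => Bool) j X)
  constructor <;> linarith [this.1, this.2]

lemma abs_noise_le {k : ℕ} (hk : Odd k) (p : unitInterval) (j : ℕ) (X : ℕ → Bool) :
    |noise k p j X| ≤ 2 / ((j : ℝ) + 2) := by
  unfold noise
  rw [abs_div, abs_of_pos (by positivity : (0 : ℝ) < (j : ℝ) + 2)]
  refine div_le_div_of_nonneg_right ?_ (by positivity)
  have := abs_sub (stepVal (X (j + 1)) : ℝ) (drift k p (avgStep X (j + 1)))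
  rw [abs_stepVal] at this
  linarith [abs_drift_le hk p X j]

/-- A function of the trajectory determined by the steps up to time `n` is measurable with respect
to the canonical filtration at time `n`. -/
lemma measurable_piLE_of_dependsOn {f : (ℕ → Bool) → ℝ} {n : ℕ}
    (hf : ∀ X Y : ℕ → Bool, (∀ t ≤ n, X t = Y t) → f X = f Y) :
    Measurable[Filtration.piLE (X := fun _ : ℕ => Bool) n] f := by
  rw [Filtration.piLE_eq_comap_frestrictLe]
  have h1 : f = (fun h : Finset.Iic n → Bool =>
      f fun t => if ht : t ≤ n then h ⟨t, Finset.mem_Iic.2 ht⟩ else false) ∘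
      Preorder.frestrictLe (π := fun _ => Bool) n := by
    funext X
    exact hf _ _ fun t ht => by simp [ht]
  rw [h1]
  exact Measurable.of_discrete.comp (comap_measurable _)

lemma walk_congr {X Y : ℕ → Bool} {n : ℕ} (h : ∀ t < n, X t = Y t) : walk X n = walk Y n :=
  Finset.sum_congr rfl fun t ht => by rw [h t (Finset.mem_range.1 ht)]

lemma noise_congr (k : ℕ) (p : ℝ) {X Y : ℕ → Bool} {j : ℕ} (h : ∀ t ≤ j + 1, X t = Y t) :
    noise k p j X = noise k p j Y := by
  unfold noise
  rw [avgStep_eq, avgStep_eq, walk_congr fun t ht => h t (by omega), h (j + 1) le_rfl]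

lemma measurable_piLE_noiseSum (k : ℕ) (p : ℝ) (m n : ℕ) :
    Measurable[Filtration.piLE (X := fun _ : ℕ => Bool) n] (noiseSum k p m n) := by
  refine measurable_piLE_of_dependsOn fun X Y h => ?_
  refine Finset.sum_congr rfl fun j hj => ?_
  have hj := Finset.mem_range.1 hj
  rw [noise_congr k p fun t ht => h t (by omega)]

lemma measurable_noiseSum (k : ℕ) (p : ℝ) (m n : ℕ) : Measurable (noiseSum k p m n) :=
  (measurable_piLE_noiseSum k p m n).mono (Filtration.le _ _) le_rfl

lemma measurable_noise (k : ℕ) (p : ℝ) (j : ℕ) : Measurable (noise k p j) :=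
  (measurable_piLE_of_dependsOn (n := j + 1) fun _ _ h => noise_congr k p h).mono
    (Filtration.le _ _) le_rfl

lemma integral_noise_eq_zero {k : ℕ} (hk : Odd k) (p : unitInterval) {j : ℕ}
    (h : Finset.Iic j → Bool) : ∫ X, noise k p j X ∂erwLaw k p h = 0 := by
  have h1 : ∀ᵐ X ∂erwLaw k p h, noise k p j X =
      (stepVal (X (j + 1)) - drift k p (initAvg h)) / ((j : ℝ) + 2) := by
    filter_upwards [ae_walk_eq k p h] with X hX
    rw [noise, avgStep_eq, hX, initAvg_eq]
    push_cast; rfl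
  have h2 : ∫ X, (stepVal (X (j + 1)) : ℝ) ∂erwLaw k p h = drift k p (initAvg h) := by
    have h3 : (erwLaw k p h).map (fun X => X (j + 1)) = erwKernel k p j h := by
      have := Kernel.map_traj_succ_self (X := fun _ => Bool) (κ := erwKernel k p) (a := j)
      rw [← this, Kernel.map_apply _ (by fun_prop)]
      rfl
    have h4 := integral_map (μ := erwLaw k p h) (φ := fun X => X (j + 1))
      (measurable_pi_apply (j + 1)).aemeasurable (f := fun b => (stepVal b : ℝ)) (by
        rw [h3]; exact (Measurable.of_discrete).aestronglyMeasurable)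
    rw [← h4, h3, integral_fintype .of_finite, Fintype.sum_bool, erwKernel_real_true hk,
      erwKernel_real_false hk, drift]
    simp [stepVal]
    ring
  have hi : Integrable (fun X : ℕ → Bool => (stepVal (X (j + 1)) : ℝ)) (erwLaw k p h) :=
    Integrable.of_bound (measurable_stepVal_apply _).aestronglyMeasurable 1
      (ae_of_all _ fun X => (abs_stepVal _).le)
  rw [integral_congr_ae h1, integral_div, integral_sub hi (integrable_const _), h2]
  simp

lemma integrable_noise {k : ℕ} (hk : Odd k) (p : unitInterval) {m : ℕ} (h : Finset.Iic m → Bool)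
    (j : ℕ) : Integrable (noise k p j) (erwLaw k p h) :=
  Integrable.of_bound (measurable_noise _ _ _).aestronglyMeasurable _
    (ae_of_all _ fun X => abs_noise_le hk p j X)

lemma condExp_noise {k : ℕ} (hk : Odd k) (p : unitInterval) {m : ℕ} (h : Finset.Iic m → Bool)
    {j : ℕ} (hj : m ≤ j) :
    (erwLaw k p h)[noise k p j | Filtration.piLE (X := fun _ : ℕ => Bool) j]
      =ᵐ[erwLaw k p h] 0 := by
  filter_upwards [Kernel.condExp_traj (X := fun _ => Bool) (κ := erwKernel k p) hj
    (integrable_noise hk p h j)] with X hX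
  exact hX.trans (integral_noise_eq_zero hk p _)

lemma abs_noiseSum_le {k : ℕ} (hk : Odd k) (p : unitInterval) (m n : ℕ) (X : ℕ → Bool) :
    |noiseSum k p m n X| ≤ n := by
  refine (Finset.abs_sum_le_sum_abs _ _).trans ?_
  have : ∀ j ∈ Finset.range n, |if m ≤ j then noise k p j X else 0| ≤ 1 := by
    intro j _
    split_ifs
    · refine (abs_noise_le hk p j X).trans ?_
      rw [div_le_one (by positivity)]
      linarith [Nat.cast_nonneg (α := ℝ) j]
    · simp
  simpa using Finset.sum_le_sum this

lemma integrable_noiseSum {k : ℕ} (hk : Odd k) (p : unitInterval) {m : ℕ} (h : Finset.Iic m → Bool)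
    (n : ℕ) : Integrable (noiseSum k p m n) (erwLaw k p h) :=
  Integrable.of_bound (measurable_noiseSum _ _ _ _).aestronglyMeasurable _
    (ae_of_all _ fun X => abs_noiseSum_le hk p m n X)

lemma integrable_noiseSum_sq {k : ℕ} (hk : Odd k) (p : unitInterval) {m : ℕ}
    (h : Finset.Iic m → Bool) (n : ℕ) :
    Integrable (fun X => noiseSum k p m n X ^ 2) (erwLaw k p h) :=
  Integrable.of_bound ((measurable_noiseSum _ _ _ _).pow_const 2).aestronglyMeasurable
    ((n : ℝ) ^ 2) (ae_of_all _ fun X => by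
      rw [Real.norm_eq_abs, abs_pow]
      exact pow_le_pow_left₀ (abs_nonneg _) (abs_noiseSum_le hk p m n X) 2)

lemma martingale_noiseSum {k : ℕ} (hk : Odd k) (p : unitInterval) {m : ℕ}
    (h : Finset.Iic m → Bool) :
    Martingale (noiseSum k p m) (Filtration.piLE (X := fun _ : ℕ => Bool)) (erwLaw k p h) := by
  refine martingale_nat (fun n => (measurable_piLE_noiseSum k p m n).stronglyMeasurable)
    (integrable_noiseSum hk p h) fun n => ?_
  have h1 : (erwLaw k p h)[noiseSum k p m n | Filtration.piLE (X := fun _ : ℕ => Bool) n] =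
      noiseSum k p m n :=
    condExp_of_stronglyMeasurable (Filtration.le _ n)
      (measurable_piLE_noiseSum k p m n).stronglyMeasurable (integrable_noiseSum hk p h n)
  by_cases hn : m ≤ n
  · have h2 : noiseSum k p m (n + 1) = noiseSum k p m n + noise k p n := by
      funext X; simp [noiseSum_succ, hn]
    rw [h2]
    filter_upwards [condExp_add (integrable_noiseSum hk p h n) (integrable_noise hk p h n)
      (Filtration.piLE (X := fun _ : ℕ => Bool) n), condExp_noise hk p h hn] with X hX hX'
    rw [hX, Pi.add_apply, hX', h1]
    simp
  · have h2 : noiseSum k p m (n + 1) = noiseSum k p m n := by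
      funext X; simp [noiseSum_succ, hn]
    rw [h2, h1]

/-- The accumulated noise is bounded in `L²`, because its increments are orthogonal. -/
lemma integral_noiseSum_sq_le {k : ℕ} (hk : Odd k) (p : unitInterval) {m : ℕ}
    (h : Finset.Iic m → Bool) (n : ℕ) :
    ∫ X, noiseSum k p m n X ^ 2 ∂erwLaw k p h ≤ 4 * (1 - 1 / ((n : ℝ) + 1)) := by
  induction n with
  | zero => simp [noiseSum]
  | succ n ih =>
    have hmono : 1 / ((n : ℝ) + 2) ^ 2 ≤ 1 / ((n : ℝ) + 1) - 1 / ((n : ℝ) + 1 + 1) := by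
      rw [div_sub_div _ _ (by positivity) (by positivity), div_le_div_iff₀ (by positivity)
        (by positivity)]
      nlinarith [Nat.cast_nonneg (α := ℝ) n]
    have hpos : 0 < 1 / ((n : ℝ) + 2) ^ 2 := by positivity
    push_cast
    by_cases hn : m ≤ n
    · have hprod : Integrable (noiseSum k p m n * noise k p n) (erwLaw k p h) :=
        (integrable_noise hk p h n).bdd_mul (measurable_noiseSum _ _ _ _).aestronglyMeasurable
          (ae_of_all _ fun X => abs_noiseSum_le hk p m n X)
      have horth : ∫ X, (noiseSum k p m n * noise k p n) X ∂erwLaw k p h = 0 := by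
        rw [← integral_condExp (Filtration.le (Filtration.piLE (X := fun _ : ℕ => Bool)) n)]
        have h1 := condExp_mul_of_stronglyMeasurable_left
          (measurable_piLE_noiseSum k p m n).stronglyMeasurable hprod (integrable_noise hk p h n)
        rw [← integral_zero (ℕ → Bool) ℝ (μ := erwLaw k p h)]
        refine integral_congr_ae ?_
        filter_upwards [h1, condExp_noise hk p h hn] with X hX hX'
        rw [hX, Pi.mul_apply, hX']; simp
      have hi1 := integrable_noiseSum_sq hk p h n
      have hb : ∀ X, noise k p n X ^ 2 ≤ 4 / ((n : ℝ) + 2) ^ 2 := by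
        intro X
        rw [← sq_abs]
        refine (pow_le_pow_left₀ (abs_nonneg _) (abs_noise_le hk p n X) 2).trans_eq ?_
        rw [div_pow]; norm_num
      have hi2 : Integrable (fun X => noise k p n X ^ 2) (erwLaw k p h) :=
        Integrable.of_bound ((measurable_noise _ _ _).pow_const 2).aestronglyMeasurable
          (4 / ((n : ℝ) + 2) ^ 2) (ae_of_all _ fun X => by
            rw [Real.norm_eq_abs, abs_of_nonneg (sq_nonneg _)]; exact hb X)
      have hexp : (fun X => noiseSum k p m (n + 1) X ^ 2) = fun X => noiseSum k p m n X ^ 2 +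
          (2 * (noiseSum k p m n * noise k p n) X + noise k p n X ^ 2) := by
        funext X
        simp only [noiseSum_succ, hn, if_true, Pi.mul_apply]; ring
      have hlast : ∫ X, noise k p n X ^ 2 ∂erwLaw k p h ≤ 4 / ((n : ℝ) + 2) ^ 2 := by
        simpa using integral_mono hi2 (integrable_const _) hb
      have hi12 : Integrable (fun X => 2 * (noiseSum k p m n * noise k p n) X +
          noise k p n X ^ 2) (erwLaw k p h) := (hprod.const_mul 2).add hi2
      rw [hexp, integral_add hi1 hi12,
        integral_add (hprod.const_mul 2) hi2, integral_const_mul, horth]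
      have : 4 / ((n : ℝ) + 2) ^ 2 = 4 * (1 / ((n : ℝ) + 2) ^ 2) := by ring
      linarith
    · have h2 : noiseSum k p m (n + 1) = noiseSum k p m n := by
        funext X; simp [noiseSum_succ, hn]
      rw [h2]
      linarith

lemma ae_exists_tendsto_noiseSum {k : ℕ} (hk : Odd k) (p : unitInterval) {m : ℕ}
    (h : Finset.Iic m → Bool) :
    ∀ᵐ X ∂erwLaw k p h, ∃ L, Tendsto (fun n => noiseSum k p m n X) atTop (𝓝 L) := by
  refine (martingale_noiseSum hk p h).submartingale.exists_ae_tendsto_of_bdd (R := 5) fun n => ?_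
  rw [eLpNorm_one_eq_lintegral_enorm,
    ← ofReal_integral_norm_eq_lintegral_enorm (integrable_noiseSum hk p h n)]
  have hi1 := integrable_noiseSum_sq hk p h n
  have h1 : ∫ X, ‖noiseSum k p m n X‖ ∂erwLaw k p h ≤
      ∫ X, (1 + noiseSum k p m n X ^ 2) ∂erwLaw k p h := by
    refine integral_mono (integrable_noiseSum hk p h n).norm ((integrable_const _).add hi1)
      fun X => ?_
    simp only [Real.norm_eq_abs]
    rw [← sq_abs]
    nlinarith [sq_nonneg (|noiseSum k p m n X| - 1), abs_nonneg (noiseSum k p m n X)]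
  rw [integral_add (integrable_const _) hi1] at h1
  have h2 := integral_noiseSum_sq_le hk p h n
  have h3 : 0 ≤ 1 / ((n : ℝ) + 1) := by positivity
  simp only [integral_const, probReal_univ, smul_eq_mul, mul_one] at h1
  have h4 : ENNReal.ofReal 5 = ((5 : NNReal) : ENNReal) := by norm_num
  rw [← h4]
  exact ENNReal.ofReal_le_ofReal (by linarith)

/-- The average step converges almost surely to an equilibrium. -/
lemma ae_exists_equilibrium {r : ℕ} (p : unitInterval)
    (hfin : {c ∈ Set.Icc (-1 : ℝ) 1 | drift (2 * r + 1) p c = c}.Finite) {m : ℕ}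
    (h : Finset.Iic m → Bool) :
    ∀ᵐ X ∂erwLaw (2 * r + 1) p h, ∃ c ∈ Set.Icc (-1 : ℝ) 1,
      drift (2 * r + 1) p c = c ∧ X ∈ ConvergesTo c := by
  filter_upwards [ae_exists_tendsto_noiseSum (odd_two_mul_add_one r) p h] with X ⟨L, hL⟩
  obtain ⟨c, hc, hFc, hlim⟩ := exists_tendsto_zero_of_field
    (F := fun c => drift (2 * r + 1) p c - c) (x := fun n => avgStep X (n + 1))
    ((continuous_drift r p).sub continuous_id) (fun n => abs_avgStep_le X _)
    (by simpa only [sub_eq_zero] using hfin) hL (by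
      filter_upwards [eventually_ge_atTop m] with n hn
      rw [avgStep_succ (2 * r + 1) p, noiseSum_succ, if_pos hn]
      ring)
  exact ⟨c, hc, by linarith, (tendsto_add_atTop_iff_nat 1).1 hlim⟩

/-! ### Staying on one side -/

lemma stepVal_mul_self (b : Bool) : (stepVal b : ℝ) * stepVal b = 1 := by
  cases b <;> norm_num [stepVal]

/-- If `±1` steps have mean at least `γ > α`, some exponential of the walk with slope `α` removed is
a supermartingale. The sign `s` selects the direction in which the walk drifts. -/
lemma exists_exp_supermartingale {α γ : ℝ} (hα : 0 ≤ α) (hαγ : α < γ) (hγ : γ ≤ 1) :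
    ∃ l > 0, ∀ s q : ℝ, |s| = 1 → 0 ≤ q → q ≤ 1 → γ ≤ s * (2 * q - 1) →
      q * Real.exp (-l * (s - α)) + (1 - q) * Real.exp (-l * (-s - α)) ≤ 1 := by
  -- with this exponent the gain `l (γ - α)` of the drift equals the second order loss `4 l ^ 2`
  refine ⟨(γ - α) / 4, by linarith, fun s q hs hq0 hq1 hg => ?_⟩
  set l := (γ - α) / 4 with hl
  have hl0 : 0 < l := by rw [hl]; linarith
  have hexp : ∀ w : ℝ, |w| ≤ 2 → Real.exp (-l * w) ≤ 1 - l * w + 4 * l ^ 2 := by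
    intro w hw
    have h1 : |-l * w| ≤ 1 := by
      rw [abs_mul, abs_neg, abs_of_pos hl0]
      nlinarith [abs_nonneg w]
    have h2 := (abs_le.1 (Real.abs_exp_sub_one_sub_id_le h1)).2
    have h3 : w ^ 2 ≤ 4 := by rw [← sq_abs]; nlinarith [abs_nonneg w]
    nlinarith [mul_le_mul_of_nonneg_left h3 (sq_nonneg l)]
  have hs' := abs_le.1 hs.le
  have h1 := hexp (s - α) (abs_le.2 ⟨by linarith, by linarith⟩)
  have h2 := hexp (-s - α) (abs_le.2 ⟨by linarith, by linarith⟩)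
  have h3 := mul_le_mul_of_nonneg_left h1 hq0
  have h4 := mul_le_mul_of_nonneg_left h2 (sub_nonneg.2 hq1)
  have h5 : l * γ ≤ l * (s * (2 * q - 1)) := mul_le_mul_of_nonneg_left hg hl0.le
  have h6 : l * γ = l * α + 4 * l ^ 2 := by rw [hl]; ring
  linarith

lemma measurableSet_fall (s α : ℝ) (n d : ℕ) :
    MeasurableSet {X : ℕ → Bool | ∃ i < d, s * walk X (n + i) < α * (n + i : ℕ)} := by
  have : {X : ℕ → Bool | ∃ i < d, s * walk X (n + i) < α * (n + i : ℕ)} =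
      ⋃ i, ⋃ _ : i < d, {X | s * walk X (n + i) < α * (n + i : ℕ)} := by
    ext; simp
  rw [this]
  exact MeasurableSet.iUnion fun i => MeasurableSet.iUnion fun _ =>
    measurableSet_lt (by fun_prop) (by fun_prop)

/-- As long as `s` times the average step is at least `α`, the walk drifts in the direction `s` at
speed `γ > α`; so it is exponentially unlikely that the average ever falls below `α`. -/
lemma erwLaw_real_fall_le {k : ℕ} (hk : Odd k) (p : unitInterval) {s α γ l : ℝ}
    (hs : |s| = 1) (hdrift : ∀ y ∈ Set.Icc α 1, γ ≤ s * drift k p (s * y)) (hl : 0 < l)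
    (hstep : ∀ q : ℝ, 0 ≤ q → q ≤ 1 → γ ≤ s * (2 * q - 1) →
      q * Real.exp (-l * (s - α)) + (1 - q) * Real.exp (-l * (-s - α)) ≤ 1)
    (d : ℕ) {m : ℕ} (h : Finset.Iic m → Bool) :
    (erwLaw k p h).real {X | ∃ i < d, s * walk X (m + 1 + i) < α * (m + 1 + i : ℕ)} ≤
      Real.exp (-l * (s * histSum h - α * (m + 1))) := by
  have hss : s * s = 1 := by rw [← abs_mul_abs_self, hs, one_mul]
  induction d generalizing m with
  | zero =>
    simp only [not_lt_zero, false_and, exists_false, Set.ofPred_false, measureReal_empty]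
    positivity
  | succ d ih =>
    rcases lt_or_ge (s * histSum h) (α * (m + 1)) with hlt | hge
    · refine measureReal_le_one.trans (Real.one_le_exp ?_)
      nlinarith
    · have hsub : (erwLaw k p h).real
          {X | ∃ i < d + 1, s * walk X (m + 1 + i) < α * (m + 1 + i : ℕ)} ≤
          (erwLaw k p h).real
          {X | ∃ i < d, s * walk X (m + 1 + 1 + i) < α * (m + 1 + 1 + i : ℕ)} := by
        refine ENNReal.toReal_mono (measure_ne_top _ _) (measure_mono_ae ?_)
        filter_upwards [ae_walk_eq k p h] with X hX
        rintro ⟨i, hi, hlt⟩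
        rcases i with _ | i
        · rw [add_zero, hX] at hlt
          push_cast at hlt
          linarith
        · exact ⟨i, by omega, by rwa [show m + 1 + 1 + i = m + 1 + (i + 1) by ring]⟩
      refine hsub.trans ?_
      rw [erwLaw_real_eq_add hk p h (measurableSet_fall _ _ _ _)]
      have hq := urnFun_initAvg_mem hk p h
      have hm : (0 : ℝ) < (m : ℝ) + 1 := by positivity
      have hav : s * initAvg h ∈ Set.Icc α 1 := by
        rw [initAvg_eq, mul_div_assoc']
        refine ⟨(le_div_iff₀ hm).2 hge, (div_le_one hm).2 ?_⟩
        refine (le_abs_self _).trans ?_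
        rw [abs_mul, hs, one_mul]
        exact abs_histSum_le h
      have hd := hdrift _ hav
      rw [← mul_assoc, hss, one_mul, drift] at hd
      have hst := hstep _ hq.1 hq.2 hd
      have ht := ih (snocHist h true)
      have hf := ih (snocHist h false)
      have e1 : Real.exp (-l * (s * histSum (snocHist h true) - α * ((m + 1 : ℕ) + 1))) =
          Real.exp (-l * (s * histSum h - α * (m + 1))) * Real.exp (-l * (s - α)) := by
        rw [← Real.exp_add, histSum_snocHist]
        congr 1
        simp only [stepVal, if_true]; push_cast; ring
      have e2 : Real.exp (-l * (s * histSum (snocHist h false) - α * ((m + 1 : ℕ) + 1))) =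
          Real.exp (-l * (s * histSum h - α * (m + 1))) * Real.exp (-l * (-s - α)) := by
        rw [← Real.exp_add, histSum_snocHist]
        congr 1
        simp only [stepVal, Bool.false_eq_true, if_false]; push_cast; ring
      rw [e1] at ht
      rw [e2] at hf
      refine (add_le_add (mul_le_mul_of_nonneg_left ht hq.1)
        (mul_le_mul_of_nonneg_left hf (sub_nonneg.2 hq.2))).trans ?_
      have := mul_le_mul_of_nonneg_left hst
        (Real.exp_pos (-l * (s * histSum h - α * (m + 1)))).le
      linarith

/-- The probability of converging to the attractor on the other side is exponentially small in the
length of the initial history. -/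
lemma exists_exp_bound {k : ℕ} (hk : Odd k) (p : unitInterval) {α γ x δ : ℝ} (hα : 0 < α)
    (hαγ : α < γ) (hγ : γ ≤ 1) (hx : 0 < x) (hαδ : α < δ)
    (hdrift : ∀ s : ℝ, |s| = 1 → ∀ y ∈ Set.Icc α 1, γ ≤ s * drift k p (s * y)) :
    ∃ c > 0, ∀ (s : ℝ), |s| = 1 → ∀ (m : ℕ) (h : Finset.Iic m → Bool), δ ≤ s * initAvg h →
      (erwLaw k p h).real (ConvergesTo (-(s * x))) ≤ Real.exp (-c * (m + 1)) := by
  obtain ⟨l, hl, hstep⟩ := exists_exp_supermartingale hα.le hαγ hγ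
  -- the initial excess of the walk over the line of slope `α` is at least `(δ - α) (m + 1)`
  refine ⟨l * (δ - α), mul_pos hl (sub_pos.2 hαδ), fun s hs m h hδ => ?_⟩
  have hss : s * s = 1 := by rw [← abs_mul_abs_self, hs, one_mul]
  have hm : (0 : ℝ) < (m : ℝ) + 1 := by positivity
  have hbound := erwLaw_real_fall_le hk p hs (hdrift s hs) hl (hstep s · hs) (h := h)
  set E : ℕ → Set (ℕ → Bool) :=
    fun d => {X | ∃ i < d, s * walk X (m + 1 + i) < α * (m + 1 + i : ℕ)} with hE
  have hmono : Monotone E := fun d e hde X ⟨i, hi, hX⟩ => ⟨i, hi.trans_le hde, hX⟩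
  have hsub : ConvergesTo (-(s * x)) ⊆ ⋃ d, E d := by
    intro X hX
    have h1 : Tendsto (fun N => s * avgStep X N) atTop (𝓝 (-x)) := by
      have := (show Tendsto (avgStep X) atTop (𝓝 (-(s * x))) from hX).const_mul s
      rwa [mul_neg, ← mul_assoc, hss, one_mul] at this
    obtain ⟨N, hN1, hN2⟩ := ((h1.eventually (gt_mem_nhds (by linarith : -x < α))).and
      (eventually_ge_atTop (m + 1))).exists
    refine Set.mem_iUnion.2 ⟨N - (m + 1) + 1, N - (m + 1), by omega, ?_⟩
    rw [Nat.add_sub_cancel' hN2]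
    have hNpos : (0 : ℝ) < N := by exact_mod_cast (by omega : 0 < N)
    rwa [avgStep_eq, mul_div_assoc', div_lt_iff₀ hNpos] at hN1
  have hle : Real.exp (-l * (s * histSum h - α * (m + 1))) ≤
      Real.exp (-(l * (δ - α)) * (m + 1)) := by
    rw [Real.exp_le_exp]
    rw [initAvg_eq, mul_div_assoc', le_div_iff₀ hm] at hδ
    nlinarith
  refine le_trans ?_ hle
  refine (measureReal_mono hsub).trans ?_
  rw [measureReal_def, hmono.measure_iUnion]
  refine ENNReal.toReal_le_of_le_ofReal (Real.exp_pos _).le (iSup_le fun d => ?_)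
  rw [← ofReal_measureReal]
  exact ENNReal.ofReal_le_ofReal (hbound d)

/-! ### Reaching either side -/

lemma urnFun_initAvg_mem_Ioo {k : ℕ} (hk : Odd k) (p : unitInterval) (hp0 : 0 < (p : ℝ))
    (hp1 : (p : ℝ) < 1) {m : ℕ} (h : Finset.Iic m → Bool) :
    urnFun k p ((1 + initAvg h) / 2) ∈ Set.Ioo (0 : ℝ) 1 := by
  have h1 := urnFun_initAvg_mem hk 1 h
  simp only [urnFun, Set.Icc.coe_one, one_mul, sub_self, zero_mul, add_zero] at h1 ⊢
  obtain ⟨h2, h3⟩ := h1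
  rcases le_total (p : ℝ) (1 / 2) with hp | hp <;> constructor <;> nlinarith

/-- An event that is possible after histories dominated by the step `b` is possible after any
history, because the walk may repeat the step `b` as long as needed. -/
lemma erwLaw_real_pos_of_majority {k : ℕ} (hk : Odd k) (p : unitInterval) (hp0 : 0 < (p : ℝ))
    (hp1 : (p : ℝ) < 1) (b : Bool) {A : Set (ℕ → Bool)} (hA : MeasurableSet A)
    (hmaj : ∀ (m : ℕ) (h : Finset.Iic m → Bool), (m : ℝ) + 1 ≤ 2 * (stepVal b * histSum h) →
      0 < (erwLaw k p h).real A) {m : ℕ} (h : Finset.Iic m → Bool) : 0 < (erwLaw k p h).real A := by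
  have key : ∀ (n m : ℕ) (h : Finset.Iic m → Bool),
      (m : ℝ) + 1 ≤ 2 * (stepVal b * histSum h) + n → 0 < (erwLaw k p h).real A := by
    intro n
    induction n with
    | zero => exact fun m h h2 => hmaj m h (by simpa using h2)
    | succ n ih =>
      intro m h h2
      have hq := urnFun_initAvg_mem_Ioo hk p hp0 hp1 h
      have hb := ih (m + 1) (snocHist h b) (by
        rw [histSum_snocHist, mul_add, stepVal_mul_self]
        push_cast at h2 ⊢
        linarith)
      rw [erwLaw_real_eq_add hk p h hA]
      cases b
      · have := mul_pos (sub_pos.2 hq.2) hb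
        have := mul_nonneg hq.1.le
          (measureReal_nonneg (μ := erwLaw k p (snocHist h true)) (s := A))
        linarith
      · have := mul_pos hq.1 hb
        have := mul_nonneg (sub_pos.2 hq.2).le
          (measureReal_nonneg (μ := erwLaw k p (snocHist h false)) (s := A))
        linarith
  obtain ⟨n, hn⟩ := exists_nat_ge ((m : ℝ) + 1 - 2 * (stepVal b * histSum h))
  exact key n m h (by linarith)

/-- An event that is negligible after all long histories is negligible after every history. -/
lemma erwLaw_real_eq_zero_of_long {k : ℕ} (hk : Odd k) (p : unitInterval) {A : Set (ℕ → Bool)}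
    (hA : MeasurableSet A) {m₀ : ℕ}
    (hlong : ∀ m (h : Finset.Iic m → Bool), m₀ ≤ m → (erwLaw k p h).real A = 0) {m : ℕ}
    (h : Finset.Iic m → Bool) : (erwLaw k p h).real A = 0 := by
  have key : ∀ n m (h : Finset.Iic m → Bool), m₀ ≤ m + n → (erwLaw k p h).real A = 0 := by
    intro n
    induction n with
    | zero => exact fun m h h1 => hlong m h h1
    | succ n ih =>
      intro m h h1
      rw [erwLaw_real_eq_add hk p h hA, ih _ _ (by omega), ih _ _ (by omega)]
      simp
  exact key m₀ m h (by omega)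

/-! ### Leaving the unstable equilibrium -/

/-- A potential for the position `S` of the walk at time `n`. It is bounded above on `|S| ≤ n`, and
near an unstable equilibrium at `0` it gains at least a multiple of `1 / n` in each step. In the
regime `S² ≫ n` its main term is `log (S / n) ^ 2`; at the diffusive scale `S² ≈ n`, where the
logarithm alone loses, the last term provides the gain. -/
noncomputable def potential (n S : ℝ) : ℝ :=
  Real.log (S ^ 2 + 3 * n) - 2 * Real.log n - 20 * (n / (S ^ 2 + 3 * n))

lemma potential_le {n S : ℝ} (hn : 1 ≤ n) (hS : |S| ≤ n) : potential n S ≤ Real.log 4 := by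
  have h1 : S ^ 2 ≤ n ^ 2 := by rw [← sq_abs]; exact pow_le_pow_left₀ (abs_nonneg S) hS 2
  have h2 : Real.log (S ^ 2 + 3 * n) ≤ Real.log (4 * n ^ 2) :=
    Real.log_le_log (by nlinarith [sq_nonneg S]) (by nlinarith)
  rw [Real.log_mul (by norm_num) (by positivity), Real.log_pow] at h2
  have h3 : 0 ≤ n / (S ^ 2 + 3 * n) := by positivity
  unfold potential
  push_cast at h2
  linarith

/-- Second order expansion of the logarithm. -/
lemma log_one_add_ge {u : ℝ} (hu : |u| ≤ 1 / 2) :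
    u - u ^ 2 / 2 - 2 * |u| ^ 3 ≤ Real.log (1 + u) := by
  have h1 := Real.abs_log_sub_add_sum_range_le (x := -u) (by rw [abs_neg]; linarith) 2
  rw [abs_neg, Finset.sum_range_succ, Finset.sum_range_one, sub_neg_eq_add] at h1
  have h2 : |u| ^ (2 + 1) / (1 - |u|) ≤ 2 * |u| ^ 3 := by
    rw [div_le_iff₀ (by linarith)]
    calc |u| ^ 3 = |u| ^ 3 * 1 := (mul_one _).symm
      _ ≤ |u| ^ 3 * (2 * (1 - |u|)) :=
        mul_le_mul_of_nonneg_left (by linarith) (by positivity)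
      _ = 2 * |u| ^ 3 * (1 - |u|) := by ring
  have h3 := (abs_le.1 (h1.trans h2)).1
  norm_num at h3
  linarith

lemma inv_one_add_le {u : ℝ} (hu : |u| ≤ 1 / 2) :
    1 / (1 + u) ≤ 1 - u + u ^ 2 + 2 * |u| ^ 3 ∧ 1 / (1 + u) ≤ 1 + 2 * |u| := by
  have h := abs_le.1 hu
  have h3 : |u| ^ 3 = |u| * u ^ 2 := by rw [← sq_abs]; ring
  constructor
  · rw [div_le_iff₀ (by linarith), h3]
    nlinarith [neg_abs_le u, le_abs_self u, mul_nonneg (abs_nonneg u) (sq_nonneg u),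
      mul_nonneg (sq_nonneg u) (by linarith [neg_abs_le u] : 0 ≤ |u| + u),
      mul_nonneg (mul_nonneg (abs_nonneg u) (sq_nonneg u)) (by linarith : 0 ≤ 1 / 2 + u)]
  · rw [div_le_iff₀ (by linarith)]
    nlinarith [neg_abs_le u, abs_nonneg u, mul_nonneg (abs_nonneg u) (by linarith : 0 ≤ 1 / 2 + u)]

/-- The change of the potential in one step `ξ`, up to third order terms. -/
lemma potential_step {n S ξ : ℝ} (hn : 100 ≤ n) (hξ : ξ ^ 2 = 1) :
    (1 + 20 * (n / (S ^ 2 + 3 * n))) * ((2 * S * ξ + 4) / (S ^ 2 + 3 * n)) -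
      (1 / 2 + 20 * (n / (S ^ 2 + 3 * n))) * (4 * S ^ 2 / (S ^ 2 + 3 * n) ^ 2) - 2 / n -
      20 / (S ^ 2 + 3 * n) - 4300 / (√(S ^ 2 + 3 * n)) ^ 3 ≤
    potential (n + 1) (S + ξ) - potential n S := by
  set R := S ^ 2 + 3 * n with hR
  set t := √R with ht
  have hR0 : 300 ≤ R := by nlinarith [sq_nonneg S]
  have htt : t ^ 2 = R := Real.sq_sqrt (by linarith)
  have ht0 : 12 ≤ t := Real.le_sqrt_of_sq_le (by nlinarith)
  have hSt : |S| ≤ t := Real.abs_le_sqrt (by nlinarith)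
  have hξ1 : |ξ| = 1 := by
    have := sq_abs ξ
    rw [hξ] at this
    nlinarith [abs_nonneg ξ]
  set u := (2 * S * ξ + 4) / R with hu
  have hR' : (S + ξ) ^ 2 + 3 * (n + 1) = R * (1 + u) := by
    rw [hu]; field_simp; rw [hR]; nlinarith
  have hSξ : |S * ξ| ≤ t := by rw [abs_mul, hξ1, mul_one]; exact hSt
  have hSξ' := abs_le.1 hSξ
  have hut : |u| ≤ 6 / t := by
    rw [hu, abs_div, abs_of_pos (by linarith : 0 < R), ← htt, div_le_div_iff₀ (by positivity)
      (by positivity)]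
    have : |2 * S * ξ + 4| ≤ 6 * t := abs_le.2 ⟨by nlinarith, by nlinarith⟩
    nlinarith
  have hu2 : |u| ≤ 1 / 2 := hut.trans (by rw [div_le_iff₀ (by positivity)]; linarith)
  have hu3 : |u| ^ 3 ≤ 216 / t ^ 3 := by
    refine (pow_le_pow_left₀ (abs_nonneg u) hut 3).trans_eq ?_
    rw [div_pow]; norm_num
  have huR : |u| / R ≤ 6 / t ^ 3 := by
    rw [← htt]
    refine (div_le_div_of_nonneg_right hut (by positivity)).trans_eq ?_
    rw [div_div]; ring_nf
  have husq : u ^ 2 ≤ 4 * S ^ 2 / R ^ 2 + 32 / t ^ 3 := by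
    -- `ξ ^ 2 = 1` removes the sign from the leading term
    have h1 : u ^ 2 = 4 * S ^ 2 / R ^ 2 + 16 * (S * ξ + 1) / R ^ 2 := by
      rw [hu, div_pow, ← add_div]
      congr 1
      linear_combination 4 * S ^ 2 * hξ
    rw [h1]
    refine add_le_add le_rfl ?_
    rw [← htt, ← pow_mul, div_le_div_iff₀ (by positivity) (by positivity)]
    have h2 : 16 * (S * ξ + 1) ≤ 32 * t := by nlinarith
    calc 16 * (S * ξ + 1) * t ^ 3 ≤ 32 * t * t ^ 3 :=
          mul_le_mul_of_nonneg_right h2 (by positivity)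
      _ = 32 * t ^ (2 * 2) := by ring
  set w := n / R with hw
  have hw0 : 0 ≤ w := by positivity
  have hw1 : w ≤ 1 / 3 := by
    rw [hw, div_le_iff₀ (by linarith)]; nlinarith [sq_nonneg S]
  have hu1 : 0 < 1 + u := by linarith [(abs_le.1 hu2).1]
  have hlog : Real.log ((S + ξ) ^ 2 + 3 * (n + 1)) = Real.log R + Real.log (1 + u) := by
    rw [hR', Real.log_mul (by positivity) hu1.ne']
  have hlogn : Real.log (n + 1) ≤ Real.log n + 1 / n := by
    have : n + 1 = n * (1 + 1 / n) := by field_simp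
    rw [this, Real.log_mul (by positivity) (by positivity)]
    have := Real.log_le_sub_one_of_pos (by positivity : 0 < 1 + 1 / n)
    linarith
  have hquot : (n + 1) / ((S + ξ) ^ 2 + 3 * (n + 1)) ≤
      w * (1 - u + u ^ 2 + 2 * |u| ^ 3) + 1 / R * (1 + 2 * |u|) := by
    have h1 : (n + 1) / ((S + ξ) ^ 2 + 3 * (n + 1)) = w * (1 / (1 + u)) + 1 / R * (1 / (1 + u)) := by
      rw [hR', hw]; field_simp
    rw [h1]
    exact add_le_add (mul_le_mul_of_nonneg_left (inv_one_add_le hu2).1 hw0)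
      (mul_le_mul_of_nonneg_left (inv_one_add_le hu2).2 (by positivity))
  have hlu := log_one_add_ge hu2
  have hc3 : 0 < 1 / t ^ 3 := by positivity
  have e1 : w * |u| ^ 3 ≤ 1 / 3 * (216 / t ^ 3) :=
    mul_le_mul hw1 hu3 (by positivity) (by norm_num)
  have e2 : (1 / 2 + 20 * w) * u ^ 2 ≤
      (1 / 2 + 20 * w) * (4 * S ^ 2 / R ^ 2) + 8 * (32 / t ^ 3) := by
    have h1 := mul_le_mul_of_nonneg_left husq (by positivity : 0 ≤ 1 / 2 + 20 * w)
    have h2 : (1 / 2 + 20 * w) * (32 / t ^ 3) ≤ 8 * (32 / t ^ 3) :=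
      mul_le_mul_of_nonneg_right (by linarith) (by positivity)
    linarith
  have e3 : 1 / R * |u| ≤ 6 / t ^ 3 := by rw [one_div_mul_eq_div]; exact huR
  have f1 : (216 : ℝ) / t ^ 3 = 216 * (1 / t ^ 3) := by ring
  have f2 : (32 : ℝ) / t ^ 3 = 32 * (1 / t ^ 3) := by ring
  have f3 : (6 : ℝ) / t ^ 3 = 6 * (1 / t ^ 3) := by ring
  have f4 : (4300 : ℝ) / t ^ 3 = 4300 * (1 / t ^ 3) := by ring
  have f5 : 20 / R = 20 * (1 / R) := by ring
  have f6 : 2 / n = 2 * (1 / n) := by ring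
  rw [f1] at e1 hu3
  rw [f2] at e2
  rw [f3] at e3
  rw [f4, f5, f6]
  unfold potential
  rw [hlog, ← hR, ← hw]
  linarith

/-- The second order part of the conditional mean gain of the potential, as a polynomial inequality
in the squared position `z = S² / n` at the diffusive scale. -/
lemma gain_polynomial {η z : ℝ} (hη : 0 < η) (hz : 0 ≤ z) :
    min η (1 / 2) * (z + 3) ^ 3 ≤ (z + 23) * (2 * (1 + η) * z + 4) * (z + 3) -
      (2 * z * (z + 3) + 80 * z) - 2 * (z + 3) ^ 3 - 20 * (z + 3) ^ 2 := by
  have h1 : min η (1 / 2) * (z + 3) ^ 2 ≤ 2 * η * z ^ 2 + z + 9 := by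
    have h2 : (z + 3) ^ 2 ≤ 2 * z ^ 2 + 18 := by nlinarith [sq_nonneg (z - 3)]
    have h3 : 0 < min η (1 / 2) := lt_min hη (by norm_num)
    nlinarith [min_le_left η (1 / 2), min_le_right η (1 / 2), sq_nonneg z,
      mul_le_mul_of_nonneg_left h2 h3.le,
      mul_nonneg (sub_nonneg.2 (min_le_left η (1 / 2))) (sq_nonneg z)]
  have h4 := mul_le_mul_of_nonneg_right h1 (by linarith : 0 ≤ z + 3)
  have h5 := mul_nonneg hη.le hz
  have h6 := mul_nonneg h5 hz
  have h7 := mul_nonneg h6 hz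
  nlinarith [sq_nonneg (z - 1)]

/-- The conditional mean gain of the potential in one step, when the next step is positive with
probability `q` and has mean at least `a S / n` in the direction of `S`, where `a > 1`. -/
lemma exists_potential_gain {a : ℝ} (ha : 1 < a) : ∃ c > 0, ∃ N : ℝ, 1 ≤ N ∧ ∀ n S q : ℝ, N ≤ n →
    0 ≤ q → q ≤ 1 → a * S ^ 2 / n ≤ S * (2 * q - 1) →
    potential n S + c / n ≤
      q * potential (n + 1) (S + 1) + (1 - q) * potential (n + 1) (S - 1) := by
  set c := min (a - 1) (1 / 2) with hc
  have hc0 : 0 < c := lt_min (by linarith) (by norm_num)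
  -- half of the gain pays for the third order error `4300 / (S ^ 2 + 3 n) ^ (3 / 2)`
  refine ⟨c / 2, by positivity, max 100 ((8600 / c) ^ 2), le_max_of_le_left (by norm_num),
    fun n S q hn hq0 hq1 hg => ?_⟩
  have hn1 : 100 ≤ n := (le_max_left _ _).trans hn
  have hn2 : 8600 / c ≤ √n := Real.le_sqrt_of_sq_le ((le_max_right _ _).trans hn)
  have hn0 : 0 < n := by linarith
  have h1 := mul_le_mul_of_nonneg_left (potential_step (S := S) (ξ := 1) hn1 (by norm_num)) hq0
  have h2 := mul_le_mul_of_nonneg_left (potential_step (S := S) (ξ := -1) hn1 (by norm_num))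
    (sub_nonneg.2 hq1)
  rw [← sub_eq_add_neg] at h2
  set R := S ^ 2 + 3 * n with hR
  have hR0 : 0 < R := by positivity
  have herr : 4300 / √R ^ 3 ≤ c / 2 / n := by
    have h3 : √n ≤ √R := Real.sqrt_le_sqrt (by nlinarith [sq_nonneg S])
    have h4 : 0 < √n := Real.sqrt_pos.2 hn0
    have h5 : √n ^ 3 ≤ √R ^ 3 := pow_le_pow_left₀ h4.le h3 3
    have h6 : √n ^ 2 = n := Real.sq_sqrt hn0.le
    refine (div_le_div_of_nonneg_left (by norm_num) (by positivity) h5).trans ?_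
    rw [div_le_iff₀ hc0] at hn2
    rw [div_le_div_iff₀ (by positivity) hn0]
    calc 4300 * n ≤ c / 2 * √n * n := mul_le_mul_of_nonneg_right (by linarith) hn0.le
      _ = c / 2 * √n ^ 3 := by rw [pow_succ, h6]; ring
  have hmain : c / n ≤ (1 + 20 * (n / R)) * ((2 * (a * S ^ 2 / n) + 4) / R) -
      (1 / 2 + 20 * (n / R)) * (4 * S ^ 2 / R ^ 2) - 2 / n - 20 / R := by
    set z := S ^ 2 / n with hz
    have hz0 : 0 ≤ z := by positivity
    have hSz : S ^ 2 = n * z := by rw [hz]; field_simp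
    have hRz : R = n * (z + 3) := by rw [hR, hSz]; ring
    have h3 := gain_polynomial (η := a - 1) (by linarith) hz0
    rw [← hc, add_sub_cancel] at h3
    have hz3 : 0 < z + 3 := by linarith
    have h4 : (1 + 20 * (n / R)) * ((2 * (a * S ^ 2 / n) + 4) / R) -
        (1 / 2 + 20 * (n / R)) * (4 * S ^ 2 / R ^ 2) - 2 / n - 20 / R =
        ((z + 23) * (2 * a * z + 4) * (z + 3) - (2 * z * (z + 3) + 80 * z) - 2 * (z + 3) ^ 3 -
          20 * (z + 3) ^ 2) / (z + 3) ^ 3 / n := by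
      rw [hRz, hSz]
      field_simp
      ring
    rw [h4]
    refine div_le_div_of_nonneg_right ?_ hn0.le
    rwa [le_div_iff₀ (by positivity)]
  have hgain : (1 + 20 * (n / R)) * ((2 * (a * S ^ 2 / n) + 4) / R) ≤
      (1 + 20 * (n / R)) * ((2 * (S * (2 * q - 1)) + 4) / R) := by
    gcongr
  have hsplit : (1 + 20 * (n / R)) * ((2 * (S * (2 * q - 1)) + 4) / R) =
      q * ((1 + 20 * (n / R)) * ((2 * S * 1 + 4) / R)) +
      (1 - q) * ((1 + 20 * (n / R)) * ((2 * S * -1 + 4) / R)) := by ring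
  have hhalf : c / 2 / n = c / n - c / 2 / n := by ring
  linarith

lemma measurableSet_stay (ε : ℝ) (n d : ℕ) :
    MeasurableSet {X : ℕ → Bool | ∀ i < d, |avgStep X (n + i)| ≤ ε} := by
  have : {X : ℕ → Bool | ∀ i < d, |avgStep X (n + i)| ≤ ε} =
      ⋂ i, ⋂ _ : i < d, {X | |avgStep X (n + i)| ≤ ε} := by
    ext; simp
  rw [this]
  exact MeasurableSet.iInter fun i => MeasurableSet.iInter fun _ =>
    measurableSet_le (measurable_avgStep _).abs measurable_const

/-- Each step spent near `0` raises the mean of the potential, which is bounded; so the walk cannot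
stay near `0` for long. -/
lemma erwLaw_real_stay_mul_le {k : ℕ} (hk : Odd k) (p : unitInterval) {a ε c N : ℝ}
    (hslope : ∀ x, |x| ≤ ε → a * x ^ 2 ≤ x * drift k p x) (hc : 0 < c) (hN : 1 ≤ N)
    (hgain : ∀ n S q : ℝ, N ≤ n → 0 ≤ q → q ≤ 1 → a * S ^ 2 / n ≤ S * (2 * q - 1) →
      potential n S + c / n ≤
        q * potential (n + 1) (S + 1) + (1 - q) * potential (n + 1) (S - 1))
    (d : ℕ) {m : ℕ} (h : Finset.Iic m → Bool) (hm : N ≤ (m : ℝ) + 1) :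
    (erwLaw k p h).real {X | ∀ i < d, |avgStep X (m + 1 + i)| ≤ ε} *
      (c * ∑ i ∈ Finset.range d, 1 / ((m : ℝ) + 1 + i)) ≤
      Real.log 4 - potential (m + 1) (histSum h) := by
  have hm0 : (0 : ℝ) < (m : ℝ) + 1 := by positivity
  have hbase := potential_le (hN.trans hm) (abs_histSum_le h)
  induction d generalizing m with
  | zero => simpa using hbase
  | succ d ih =>
    by_cases hε : |initAvg h| ≤ ε
    · have hsub : (erwLaw k p h).real {X | ∀ i < d + 1, |avgStep X (m + 1 + i)| ≤ ε} ≤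
          (erwLaw k p h).real {X | ∀ i < d, |avgStep X (m + 1 + 1 + i)| ≤ ε} := by
        refine measureReal_mono fun X hX i hi => ?_
        rw [show m + 1 + 1 + i = m + 1 + (i + 1) by ring]
        exact hX (i + 1) (by omega)
      have hq := urnFun_initAvg_mem hk p h
      have hsum : ∑ i ∈ Finset.range (d + 1), 1 / ((m : ℝ) + 1 + i) =
          1 / ((m : ℝ) + 1) + ∑ i ∈ Finset.range d, 1 / (((m + 1 : ℕ) : ℝ) + 1 + i) := by
        rw [Finset.sum_range_succ', add_comm]
        congr 1
        · simp
        · refine Finset.sum_congr rfl fun i _ => ?_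
          push_cast; congr 1; ring
      have hs0 : 0 ≤ ∑ i ∈ Finset.range d, 1 / (((m + 1 : ℕ) : ℝ) + 1 + i) :=
        Finset.sum_nonneg fun i _ => by positivity
      have hih : ∀ b : Bool, (erwLaw k p (snocHist h b)).real
          {X | ∀ i < d, |avgStep X (m + 1 + 1 + i)| ≤ ε} *
          (c * ∑ i ∈ Finset.range d, 1 / (((m + 1 : ℕ) : ℝ) + 1 + i)) ≤
          Real.log 4 - potential ((m : ℝ) + 1 + 1) (histSum h + stepVal b) := by
        intro b
        have h1 : N ≤ ((m + 1 : ℕ) : ℝ) + 1 := by push_cast; linarith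
        have h2 := ih (snocHist h b) h1 (by positivity)
          (potential_le (hN.trans h1) (abs_histSum_le _))
        rw [histSum_snocHist] at h2
        push_cast at h2 ⊢
        exact h2
      have ht := mul_le_mul_of_nonneg_left (hih true) hq.1
      have hf := mul_le_mul_of_nonneg_left (hih false) (sub_nonneg.2 hq.2)
      simp only [stepVal, if_true, Bool.false_eq_true, if_false, Int.cast_one, Int.cast_neg,
        ← sub_eq_add_neg] at ht hf
      have hcond : a * histSum h ^ 2 / ((m : ℝ) + 1) ≤
          histSum h * (2 * urnFun k p ((1 + initAvg h) / 2) - 1) := by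
        have h1 := hslope _ hε
        have h2 : histSum h = ((m : ℝ) + 1) * initAvg h := by
          rw [initAvg_eq]; field_simp
        rw [← drift, h2]
        have h3 := mul_le_mul_of_nonneg_left h1 hm0.le
        calc a * (((m : ℝ) + 1) * initAvg h) ^ 2 / ((m : ℝ) + 1)
            = ((m : ℝ) + 1) * (a * initAvg h ^ 2) := by field_simp
          _ ≤ _ := h3
          _ = _ := by ring
      have hg := hgain _ _ _ hm hq.1 hq.2 hcond
      have hle1 := measureReal_le_one (μ := erwLaw k p h)
        (s := {X | ∀ i < d + 1, |avgStep X (m + 1 + i)| ≤ ε})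
      rw [hsum]
      have h5 : (erwLaw k p h).real {X | ∀ i < d + 1, |avgStep X (m + 1 + i)| ≤ ε} *
          (c * (1 / ((m : ℝ) + 1))) ≤ c / ((m : ℝ) + 1) := by
        rw [mul_one_div]
        exact mul_le_of_le_one_left (by positivity) hle1
      have h6 := mul_le_mul_of_nonneg_right hsub (mul_nonneg hc.le hs0)
      rw [erwLaw_real_eq_add hk p h (measurableSet_stay ε (m + 1 + 1) d)] at h6
      linarith
    · have hzero : (erwLaw k p h).real {X | ∀ i < d + 1, |avgStep X (m + 1 + i)| ≤ ε} = 0 := by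
        rw [measureReal_eq_zero_iff, measure_eq_zero_iff_ae_notMem]
        filter_upwards [ae_walk_eq k p h] with X hX hstay
        refine hε ?_
        have h1 := hstay 0 (by omega)
        rw [add_zero, avgStep_eq, hX] at h1
        rw [initAvg_eq]
        exact_mod_cast h1
      rw [hzero, zero_mul]
      linarith

/-- The average step does not converge to an unstable equilibrium at `0`. -/
lemma ae_not_convergesTo_zero {k : ℕ} (hk : Odd k) (p : unitInterval) {a ε : ℝ} (ha : 1 < a)
    (hε : 0 < ε) (hslope : ∀ x, |x| ≤ ε → a * x ^ 2 ≤ x * drift k p x) {m : ℕ}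
    (h : Finset.Iic m → Bool) : ∀ᵐ X ∂erwLaw k p h, X ∉ ConvergesTo 0 := by
  obtain ⟨c, hc, N, hN, hgain⟩ := exists_potential_gain ha
  have hmeas : ∀ n : ℕ, MeasurableSet {X : ℕ → Bool | ∀ i, |avgStep X (n + i)| ≤ ε} := by
    intro n
    rw [Set.ofPred_forall]
    exact MeasurableSet.iInter fun i => measurableSet_le (measurable_avgStep _).abs measurable_const
  have hstay : ∀ n : ℕ, (erwLaw k p h).real {X | ∀ i, |avgStep X (n + i)| ≤ ε} = 0 := by
    intro n
    obtain ⟨N', hN'⟩ := exists_nat_ge N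
    refine erwLaw_real_eq_zero_of_long hk p (hmeas n) (m₀ := max n N') (fun m h hm => ?_) h
    have hm1 : N ≤ (m : ℝ) + 1 := by
      have : (N' : ℝ) ≤ m := by exact_mod_cast (le_max_right _ _).trans hm
      linarith
    set P := (erwLaw k p h).real {X | ∀ i, |avgStep X (n + i)| ≤ ε} with hP
    by_contra hne
    have hP0 : 0 < P := lt_of_le_of_ne measureReal_nonneg (Ne.symm hne)
    have h1 : ∀ d : ℕ, P * c * ∑ i ∈ Finset.range d, 1 / (((i + m : ℕ) : ℝ) + 1) ≤
        Real.log 4 - potential (m + 1) (histSum h) := by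
      intro d
      refine le_trans ?_ (erwLaw_real_stay_mul_le hk p hslope hc hN hgain d h hm1)
      rw [mul_assoc]
      have h2 : ∑ i ∈ Finset.range d, 1 / (((i + m : ℕ) : ℝ) + 1) =
          ∑ i ∈ Finset.range d, 1 / ((m : ℝ) + 1 + i) :=
        Finset.sum_congr rfl fun i _ => by push_cast; congr 1; ring
      rw [h2]
      refine mul_le_mul_of_nonneg_right (measureReal_mono fun X hX i _ => ?_)
        (mul_nonneg hc.le (Finset.sum_nonneg fun i _ => by positivity))
      have hnm := (le_max_left _ _).trans hm
      have h3 := hX (m + 1 + i - n)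
      rwa [Nat.add_sub_cancel' (by omega)] at h3
    obtain ⟨d, hd⟩ := (((tendsto_sum_one_div_add_atTop m).const_mul_atTop (mul_pos hP0 hc)).eventually_gt_atTop
      (Real.log 4 - potential (m + 1) (histSum h))).exists
    exact absurd (h1 d) (not_le.2 hd)
  have hall : ∀ᵐ X ∂erwLaw k p h, ∀ n : ℕ, ¬∀ i, |avgStep X (n + i)| ≤ ε := by
    rw [ae_all_iff]
    intro n
    have := hstay n
    rw [measureReal_eq_zero_iff, measure_eq_zero_iff_ae_notMem] at this
    exact this
  filter_upwards [hall] with X hX hconv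
  obtain ⟨n, hn⟩ := eventually_atTop.1 ((Metric.tendsto_nhds.1 hconv) ε hε)
  refine hX n fun i => ?_
  have := hn (n + i) (by omega)
  rw [Real.dist_eq, sub_zero] at this
  exact this.le

/-! ### The two phases -/

lemma urnFun_fixed_iff (r : ℕ) (p y : ℝ) :
    urnFun (2 * r + 1) p y = y ↔ (2 * p - 1) * centeredMaj r (y - 1 / 2) = y - 1 / 2 := by
  have h := urnFun_half_add r p (y - 1 / 2)
  rw [add_sub_cancel] at h
  rw [h]
  constructor <;> intro h <;> linarith

lemma drift_fixed_iff (r : ℕ) (p c : ℝ) :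
    drift (2 * r + 1) p c = c ↔ (2 * p - 1) * centeredMaj r (c / 2) = c / 2 := by
  rw [drift_eq]
  constructor <;> intro h <;> linarith

lemma oneAttractorPhase_of_subcritical {r : ℕ} {p : unitInterval}
    (hp : (2 * (p : ℝ) - 1) * maxSlope r < 1) : OneAttractorPhase (2 * r + 1) p := by
  refine ⟨fun y hy => ?_, ?_, fun m h => ?_⟩
  · rw [urnFun_fixed_iff, subcritical_fixed_iff hp ⟨by linarith [hy.1], by linarith [hy.2]⟩,
      sub_eq_zero]
  · have h1 := hasDerivAt_urnFun r p 0 (hasDerivAt_centeredMaj_zero r)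
    rw [add_zero] at h1
    refine isDownCrossing_of_hasDerivAt h1 hp ?_
    rw [urnFun_fixed_iff, sub_self, centeredMaj_zero, mul_zero]
  · have hzero : ∀ c ∈ Set.Icc (-1 : ℝ) 1, drift (2 * r + 1) p c = c → c = 0 := by
      intro c hc h
      rw [drift_fixed_iff,
        subcritical_fixed_iff hp ⟨by linarith [hc.1], by linarith [hc.2]⟩] at h
      linarith
    have hfin : {c ∈ Set.Icc (-1 : ℝ) 1 | drift (2 * r + 1) p c = c}.Finite :=
      (Set.finite_singleton 0).subset fun c hc => hzero c hc.1 hc.2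
    filter_upwards [ae_exists_equilibrium p hfin h] with X ⟨c, hc, hc', hX⟩
    rwa [hzero c hc hc'] at hX

lemma twoAttractorsPhase_of_supercritical {r : ℕ} {p : unitInterval}
    (hp : 1 < (2 * (p : ℝ) - 1) * maxSlope r) {v : ℝ} (hv0 : 0 < v) (hv1 : v ≤ 1 / 2)
    (hv : (2 * (p : ℝ) - 1) * centeredMaj r v = v) :
    TwoAttractorsPhase (2 * r + 1) p (2 * v) := by
  have hodd := odd_two_mul_add_one r
  have hp1 : (p : ℝ) ≤ 1 := p.2.2
  have hq0 : 0 < 2 * (p : ℝ) - 1 := by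
    by_contra! hle
    nlinarith [maxSlope_pos r]
  have hr : 0 < r := by
    rcases Nat.eq_zero_or_pos r with rfl | hr
    · norm_num [maxSlope] at hp
      linarith
    · exact hr
  have hneg : (2 * (p : ℝ) - 1) * centeredMaj r (-v) = -v := by rw [centeredMaj_neg]; linarith
  have hzero : ∀ c ∈ Set.Icc (-1 : ℝ) 1, drift (2 * r + 1) p c = c →
      c = -(2 * v) ∨ c = 0 ∨ c = 2 * v := by
    intro c hc h
    rw [drift_fixed_iff,
      supercritical_fixed_iff hr hq0 hv0 hv1 hv ⟨by linarith [hc.1], by linarith [hc.2]⟩] at h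
    rcases h with h | h | h
    · left; linarith
    · right; left; linarith
    · right; right; linarith
  have hlim : ∀ (m : ℕ) (h : Finset.Iic m → Bool), ∀ᵐ X ∂erwLaw (2 * r + 1) p h,
      X ∈ ConvergesTo (-(2 * v)) ∨ X ∈ ConvergesTo (2 * v) := by
    intro m h
    have hfin : {c ∈ Set.Icc (-1 : ℝ) 1 | drift (2 * r + 1) p c = c}.Finite :=
      (Set.toFinite {-(2 * v), 0, 2 * v}).subset fun c hc => hzero c hc.1 hc.2
    obtain ⟨a, ε, ha, hε, hslope⟩ := exists_supercritical_slope hp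
    have hne := ae_not_convergesTo_zero hodd p ha (mul_pos two_pos hε) (fun x hx => by
      have := hslope (x / 2) (by rw [abs_div, abs_two]; linarith)
      rw [drift_eq]
      linarith) h
    filter_upwards [ae_exists_equilibrium p hfin h, hne] with X ⟨c, hc, hc', hX⟩ hX0
    rcases hzero c hc hc' with rfl | rfl | rfl
    · exact Or.inl hX
    · exact absurd hX hX0
    · exact Or.inr hX
  have hexp : ∀ δ : ℝ, 0 < δ → ∃ c > 0, ∀ s : ℝ, |s| = 1 → ∀ (m : ℕ) (h : Finset.Iic m → Bool),
      δ ≤ s * initAvg h → (erwLaw (2 * r + 1) p h).real (ConvergesTo (-(s * (2 * v)))) ≤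
        Real.exp (-c * (m + 1)) := by
    intro δ hδ
    -- a level below both `δ` and the attractor `2 v`, so that the drift there exceeds it
    set α := min v (δ / 2) with hα
    have hα0 : 0 < α := lt_min hv0 (by linarith)
    have hαv : α ≤ v := min_le_left _ _
    have hαδ : α < δ := (min_le_right _ _).trans_lt (by linarith)
    have hmono : ∀ y ∈ Set.Icc α 1, ∀ z ∈ Set.Icc α 1, y ≤ z →
        drift (2 * r + 1) p y ≤ drift (2 * r + 1) p z := by
      intro y hy z hz hyz
      rw [drift_eq, drift_eq]
      have := monotoneOn_centeredMaj r (a := y / 2) (b := z / 2)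
        ⟨by linarith [hy.1], by linarith [hy.2]⟩ ⟨by linarith [hz.1], by linarith [hz.2]⟩
        (by linarith)
      nlinarith
    refine exists_exp_bound hodd p (γ := drift (2 * r + 1) p α) hα0 ?_ ?_ (by linarith) hαδ ?_
    · rw [drift_eq]
      have := lt_of_lt_fixed hr hq0 hv1 hv (u := α / 2) (by linarith) (by linarith)
      linarith
    · refine (hmono α ⟨le_rfl, by linarith⟩ 1 ⟨by linarith, le_rfl⟩ (by linarith)).trans ?_
      rw [drift_eq, centeredMaj_half]
      linarith
    · intro s hs y hy
      have hs2 : s * drift (2 * r + 1) p (s * y) = drift (2 * r + 1) p y := by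
        rcases eq_or_eq_neg_of_abs_eq hs with rfl | rfl
        · rw [one_mul, one_mul]
        · rw [drift_eq, drift_eq, show -1 * y / 2 = -(y / 2) by ring, centeredMaj_neg]; ring
      rw [hs2]
      exact hmono α ⟨le_rfl, by linarith⟩ y hy hy.1
  have hup : (1 + 2 * v) / 2 = 1 / 2 + v := by ring
  have hdown : (1 - 2 * v) / 2 = 1 / 2 + -v := by ring
  refine ⟨by linarith, by linarith, fun y hy => ?_, ?_, ?_, ?_, hlim, fun hlt m h => ?_,
    fun δ hδ => ?_⟩
  · rw [urnFun_fixed_iff, supercritical_fixed_iff hr hq0 hv0 hv1 hv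
      ⟨by linarith [hy.1], by linarith [hy.2]⟩, hup, hdown]
    refine or_congr ?_ (or_congr ?_ ?_) <;> constructor <;> intro h <;> linarith
  · have h1 := hasDerivAt_urnFun r p 0 (hasDerivAt_centeredMaj_zero r)
    rw [add_zero] at h1
    refine isUpCrossing_of_hasDerivAt h1 hp ?_
    rw [urnFun_fixed_iff, sub_self, centeredMaj_zero, mul_zero]
  · rw [hdown]
    refine isDownCrossing_of_hasDerivAt (hasDerivAt_urnFun r p (-v) (hasDerivAt_centeredMaj r _))
      ?_ ?_
    · rw [neg_sq]
      exact slope_fixed_lt_one hr hq0 hv0 hv1 hv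
    · rw [urnFun_fixed_iff, add_sub_cancel_left, hneg]
  · rw [hup]
    refine isDownCrossing_of_hasDerivAt (hasDerivAt_urnFun r p v (hasDerivAt_centeredMaj r _))
      (slope_fixed_lt_one hr hq0 hv0 hv1 hv) ?_
    rw [urnFun_fixed_iff, add_sub_cancel_left, hv]
  · have hp0 : 0 < (p : ℝ) := by linarith
    obtain ⟨c, hc, hbound⟩ := hexp (1 / 2) (by norm_num)
    have hpos : ∀ b : Bool,
        0 < (erwLaw (2 * r + 1) p h).real (ConvergesTo (stepVal b * (2 * v))) := by
      intro b
      refine erwLaw_real_pos_of_majority hodd p hp0 hlt b (measurableSet_convergesTo _)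
        (fun m h hmaj => ?_) h
      have hm : (0 : ℝ) < (m : ℝ) + 1 := by positivity
      have h1 := hbound (stepVal b) (abs_stepVal b) m h (by
        rw [initAvg_eq, mul_div_assoc', le_div_iff₀ hm]; linarith)
      have h2 : Real.exp (-c * (m + 1)) < 1 := Real.exp_lt_one_iff.2 (by nlinarith)
      have h3 : (erwLaw (2 * r + 1) p h).real
          (ConvergesTo (-(stepVal b * (2 * v))) ∪ ConvergesTo (stepVal b * (2 * v))) = 1 := by
        rw [← probReal_univ (μ := erwLaw (2 * r + 1) p h)]
        refine measureReal_congr ?_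
        filter_upwards [hlim m h] with X hX
        refine propext (iff_of_true (show X ∈ ConvergesTo (-(stepVal b * (2 * v))) ∪
          ConvergesTo (stepVal b * (2 * v)) from ?_) trivial)
        cases b
        · simpa [stepVal] using hX.symm
        · simpa [stepVal] using hX
      have h4 := measureReal_union_le (μ := erwLaw (2 * r + 1) p h)
        (ConvergesTo (-(stepVal b * (2 * v)))) (ConvergesTo (stepVal b * (2 * v)))
      linarith
    have hf := hpos false
    have ht := hpos true
    simp only [stepVal, if_true, Bool.false_eq_true, if_false, Int.cast_one, Int.cast_neg, one_mul,
      neg_mul, measureReal_def] at hf ht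
    exact ⟨(ENNReal.toReal_pos_iff.1 hf).1, (ENNReal.toReal_pos_iff.1 ht).1⟩
  · obtain ⟨c, hc, hbound⟩ := hexp δ hδ
    refine ⟨1, c, hc, fun m h => ⟨fun hh => ?_, fun hh => ?_⟩⟩
    · simpa using hbound 1 abs_one m h (by linarith)
    · simpa using hbound (-1) (by simp) m h (by linarith)

theorem mainTheorem2 :
    -- one extraction
    (∀ p : unitInterval, (p : ℝ) < 1 → OneAttractorPhase 1 p) ∧
    -- three extractions: the real solutions of `π_3(y) = y`
    (∀ p : unitInterval, ((p : ℝ) < 1 / 2 ∨ 5 / 6 ≤ (p : ℝ)) →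
      0 ≤ 12 * (p : ℝ) ^ 2 - 16 * (p : ℝ) + 5 ∧
      ∀ y : ℝ, urnFun 3 p y = y ↔ y = 1 / 2 ∨ y = yPlus p ∨ y = yMinus p) ∧
    (∀ p : unitInterval, 1 / 2 ≤ (p : ℝ) → (p : ℝ) < 5 / 6 →
      ∀ y : ℝ, urnFun 3 p y = y ↔ y = 1 / 2) ∧
    -- three extractions: the two phases
    (∀ p : unitInterval, (p : ℝ) < 5 / 6 → OneAttractorPhase 3 p) ∧
    (∀ p : unitInterval, 5 / 6 < (p : ℝ) → TwoAttractorsPhase 3 p (xPlus p)) ∧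
    -- every odd number of extractions greater than two
    (∀ k : ℕ, Odd k → 2 < k → ∃ pc : ℝ, 1 / 2 < pc ∧ pc < 1 ∧
      (∀ p : unitInterval, (p : ℝ) < pc → OneAttractorPhase k p) ∧
      (∀ p : unitInterval, pc < (p : ℝ) → ∃ x : ℝ, TwoAttractorsPhase k p x)) := by
  refine ⟨fun p hp => ?_, fun p hp => ?_, fun p hp1 hp2 y => ?_, fun p hp => ?_, fun p hp => ?_,
    ?_⟩
  · exact oneAttractorPhase_of_subcritical (r := 0) (by norm_num [maxSlope]; linarith)
  · have hdisc : 0 ≤ 12 * (p : ℝ) ^ 2 - 16 * p + 5 := by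
      rcases hp with hp | hp <;> nlinarith
    refine ⟨hdisc, fun y => ?_⟩
    have hq : 2 * (p : ℝ) - 1 ≠ 0 := by
      rcases hp with hp | hp
      · exact (by linarith : 2 * (p : ℝ) - 1 < 0).ne
      · exact (by linarith : 0 < 2 * (p : ℝ) - 1).ne'
    rw [urnFun_three_fixed_iff, sub_eq_zero]
    refine or_congr Iff.rfl ?_
    have hsq := Real.sq_sqrt hdisc
    -- the discriminant is `(2 p - 1) (6 p - 5)`
    have h1 : 4 * (2 * (p : ℝ) - 1) * (y - 1 / 2) ^ 2 = 6 * p - 5 ↔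
        (2 * (2 * (p : ℝ) - 1) * (y - 1 / 2)) ^ 2 = √(12 * (p : ℝ) ^ 2 - 16 * p + 5) ^ 2 := by
      rw [hsq]
      constructor <;> intro h
      · linear_combination (2 * (p : ℝ) - 1) * h
      · refine mul_left_cancel₀ hq ?_
        linear_combination h
    rw [h1, sq_eq_sq_iff_eq_or_eq_neg, yPlus, yMinus]
    have hq2 : 2 * (2 * (p : ℝ) - 1) ≠ 0 := mul_ne_zero two_ne_zero hq
    refine or_congr ?_ ?_
    · rw [← sub_eq_iff_eq_add', eq_div_iff hq2, mul_comm]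
    · rw [sub_eq_add_neg (1 / 2 : ℝ), ← neg_div, ← sub_eq_iff_eq_add', eq_div_iff hq2, mul_comm]
  · rw [urnFun_three_fixed_iff, sub_eq_zero]
    refine or_iff_left fun h => ?_
    nlinarith [mul_nonneg (by linarith : 0 ≤ 2 * (p : ℝ) - 1) (sq_nonneg (y - 1 / 2))]
  · exact oneAttractorPhase_of_subcritical (r := 1) (by rw [maxSlope_one]; linarith)
  · have hp1 : (p : ℝ) ≤ 1 := p.2.2
    have hq : 0 < 2 * (p : ℝ) - 1 := by linarith
    have hdisc : 0 < 12 * (p : ℝ) ^ 2 - 16 * p + 5 := by nlinarith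
    have hx : xPlus p = 2 * (xPlus p / 2) := by ring
    have hx0 : 0 < xPlus p := div_pos (Real.sqrt_pos.2 hdisc) hq
    rw [hx]
    refine twoAttractorsPhase_of_supercritical (r := 1) (by rw [maxSlope_one]; linarith)
      (by linarith) ?_ ?_
    · have : xPlus p ≤ 1 := by
        rw [xPlus, div_le_one hq, Real.sqrt_le_left hq.le]
        nlinarith
      linarith
    · have hsq : (2 * (p : ℝ) - 1) * xPlus p ^ 2 = 6 * p - 5 := by
        rw [xPlus, div_pow, Real.sq_sqrt hdisc.le]
        field_simp
        ring
      rw [centeredMaj_three]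
      linear_combination (-xPlus p / 4) * hsq
  · rintro k ⟨r, rfl⟩ hk
    have hr : 0 < r := by omega
    have h1 := one_lt_maxSlope hr
    have h0 := maxSlope_pos r
    have hinv : 1 / maxSlope r < 1 := (div_lt_one h0).2 h1
    -- the critical value, at which the slope of the urn function at `1 / 2` is one
    refine ⟨(1 + 1 / maxSlope r) / 2, ?_, by linarith, fun p hp => ?_, fun p hp => ?_⟩
    · have : 0 < 1 / maxSlope r := by positivity
      linarith
    · exact oneAttractorPhase_of_subcritical
        ((lt_div_iff₀ h0).1 (by linarith : 2 * (p : ℝ) - 1 < 1 / maxSlope r))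
    · have hsup : 1 < (2 * (p : ℝ) - 1) * maxSlope r :=
        (div_lt_iff₀ h0).1 (by linarith : 1 / maxSlope r < 2 * (p : ℝ) - 1)
      obtain ⟨v, hv0, hv1, hv⟩ := exists_supercritical_fixed (by linarith [p.2.2]) hsup
      exact ⟨2 * v, twoAttractorsPhase_of_supercritical hsup hv0 hv1 hv⟩
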